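/- Let $f$ be a complex-valued harmonic mapping in the unit disk $\mathbb{D}=\{z\in\mathbb{C}:|z|<1\}$ that is locally univalent (every point of $\mathbb{D}$ has a neighbourhood on which $f$ is injective), and suppose that its dilatation $\omega=\overline{f_{\overline z}}/f_z$ maps $\mathbb{D}$ into $\mathbb{D}$. Let $J_f=|f_z|^2-|f_{\overline z}|^2$ be the Jacobian of $f$, let $$P_f=(\log J_f)_z,\qquad S_f=(P_f)_z-\tfrac12 (P_f)^2$$ be its pre-Schwarzian and Schwarzian derivatives, and put $$\omega^*(z)=\frac{(1-|z|^2)\,\omega'(z)}{1-|\omega(z)|^2},\qquad A_f(z)=\tfrac12(1-|z|^2)P_f(z)-\overline z,\qquad z\in\mathbb{D}.$$ If $$(1-|z|^2)^2|S_f(z)|+2|\omega^*(z)A_f(z)|\le\tfrac12|\omega^*(z)|^2\qquad\text{for all } z\in\mathbb{D},$$ then $f$ is injective in $\mathbb{D}$. -/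

import Mathlib

noncomputable section

namespace PlanarHarmonic

/-- The complex-linear Wirtinger derivative `f_z = (f_x - i f_y) / 2`. -/
def dz (f : ℂ → ℂ) (z : ℂ) : ℂ :=
  (fderiv ℝ f z 1 - Complex.I * fderiv ℝ f z Complex.I) / 2

/-- The conjugate Wirtinger derivative, `(f_x + i f_y) / 2`. -/
def dzbar (f : ℂ → ℂ) (z : ℂ) : ℂ :=
  (fderiv ℝ f z 1 + Complex.I * fderiv ℝ f z Complex.I) / 2

/-- The Jacobian: the squared modulus of the first Wirtinger derivative minus that of
the second. -/
def jacobian (f : ℂ → ℂ) (z : ℂ) : ℝ := ‖dz f z‖ ^ 2 - ‖dzbar f z‖ ^ 2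

/-- The dilatation `ω`, the conjugate of `dzbar f` divided by `dz f`. -/
def dilatation (f : ℂ → ℂ) (z : ℂ) : ℂ := (starRingEnd ℂ) (dzbar f z) / dz f z

/-- The pre-Schwarzian derivative `P_f = (log J_f)_z`. -/
def preSchwarzian (f : ℂ → ℂ) : ℂ → ℂ := dz fun w => (Real.log (jacobian f w) : ℂ)

/-- The Schwarzian derivative `S_f = (P_f)_z - (P_f)² / 2`. -/
def schwarzian (f : ℂ → ℂ) (z : ℂ) : ℂ :=
  dz (preSchwarzian f) z - (1 / 2) * preSchwarzian f z ^ 2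

/-- The hyperbolic derivative `(1 - |z|²) ω'(z) / (1 - |ω(z)|²)` of a self-map of the disk. -/
def hyperbolicDeriv (ω : ℂ → ℂ) (z : ℂ) : ℂ :=
  (1 - (‖z‖ : ℂ) ^ 2) * deriv ω z / (1 - (‖ω z‖ : ℂ) ^ 2)

/-- The harmonic order operator `A_f(z) = (1 - |z|²) P_f(z) / 2 - conj z`. -/
def harmonicOrder (f : ℂ → ℂ) (z : ℂ) : ℂ :=
  (1 / 2) * (1 - (‖z‖ : ℂ) ^ 2) * preSchwarzian f z - (starRingEnd ℂ) z

/-- `f` is locally univalent in `U`: every point of `U` has a neighbourhood in `U` on which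
`f` is injective. -/
def LocallyUnivalentOn (f : ℂ → ℂ) (U : Set ℂ) : Prop := IsLocallyInjective (U.domRestrict f)

end PlanarHarmonic

end

/-! Write `f = h + conj g` with `h`, `g` holomorphic. Since `∂_z` does not see conjugated factors,
`P_f` and `S_f` at a point `z` are those of the holomorphic shear `h + a * g` with the frozen
parameter `a = -conj (ω z)`. Comparing this shear with the ones for `‖a‖ = 1` gives, with `ω⋆` the
hyperbolic derivative of `ω` and some `κ` of modulus one,
`(1 - |z|²)² S_{h + a g} = (1 - |z|²)² S_f - 2 κ ω⋆ A_f - (3/2) κ² ω⋆² + κ ω⋆⋆`,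
where the second-order hyperbolic derivative `ω⋆⋆` satisfies `|ω⋆⋆| ≤ 2 (1 - |ω⋆|²)` by the
Schwarz–Pick lemma. Under the hypothesis the right-hand side is at most `2` in modulus, so every
such shear is injective by Nehari's criterion. If `f z = f w`, then some shear with `‖a‖ = 1` takes
the same value at `z` and `w`, whence `z = w`. Nehari's criterion needs `h' + a g'` not to vanish,
which is Lewy's theorem for `f`. -/

open Metric Set Filter Topology ComplexConjugate

namespace PlanarHarmonic

section DiskMobius

lemma one_sub_norm_sq_pos {z : ℂ} (hz : z ∈ ball (0 : ℂ) 1) : 0 < 1 - ‖z‖ ^ 2 := by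
  rw [mem_ball_zero_iff] at hz
  nlinarith [norm_nonneg z]

lemma one_add_mul_ne_zero {a b : ℂ} (ha : ‖a‖ ≤ 1) (hb : b ∈ ball (0 : ℂ) 1) :
    1 + a * b ≠ 0 := by
  intro h
  have hab : ‖a‖ * ‖b‖ = 1 := by
    rw [← norm_mul, show a * b = -1 by linear_combination h, norm_neg, norm_one]
  rw [mem_ball_zero_iff] at hb
  nlinarith [norm_nonneg a, norm_nonneg b]

lemma one_add_conj_mul_ne_zero {c w : ℂ} (hc : c ∈ ball (0 : ℂ) 1) (hw : w ∈ ball (0 : ℂ) 1) :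
    1 + conj c * w ≠ 0 :=
  one_add_mul_ne_zero (by simpa using (mem_ball_zero_iff.1 hc).le) hw

/-- The Möbius map `w ↦ (w + c) / (1 + c̄ w)`; for `‖c‖ < 1` it is the automorphism of the unit
disk that takes `0` to `c`. -/
noncomputable def diskMobius (c w : ℂ) : ℂ := (w + c) / (1 + conj c * w)

variable {c w : ℂ}

@[simp]
lemma diskMobius_zero (c : ℂ) : diskMobius c 0 = c := by
  simp [diskMobius]

@[simp]
lemma diskMobius_neg_self (c : ℂ) : diskMobius (-c) c = 0 := by
  simp [diskMobius]

lemma one_sub_norm_diskMobius_sq (hne : 1 + conj c * w ≠ 0) :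
    1 - ‖diskMobius c w‖ ^ 2 = (1 - ‖c‖ ^ 2) * (1 - ‖w‖ ^ 2) / ‖1 + conj c * w‖ ^ 2 := by
  have hpos : ‖1 + conj c * w‖ ^ 2 ≠ 0 := by positivity
  rw [diskMobius, norm_div, div_pow, eq_div_iff hpos, sub_mul, div_mul_cancel₀ _ hpos]
  simp only [← Complex.normSq_eq_norm_sq, Complex.normSq_apply, Complex.add_re, Complex.add_im,
    Complex.mul_re, Complex.mul_im, Complex.conj_re, Complex.conj_im, Complex.one_re,
    Complex.one_im]
  ring

lemma diskMobius_mem_ball (hc : c ∈ ball (0 : ℂ) 1) (hw : w ∈ ball (0 : ℂ) 1) :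
    diskMobius c w ∈ ball (0 : ℂ) 1 := by
  have hne := one_add_conj_mul_ne_zero hc hw
  have hpos : 0 < 1 - ‖diskMobius c w‖ ^ 2 := by
    rw [one_sub_norm_diskMobius_sq hne]
    have := one_sub_norm_sq_pos hc
    have := one_sub_norm_sq_pos hw
    positivity
  rw [mem_ball_zero_iff]
  nlinarith [norm_nonneg (diskMobius c w)]

lemma mapsTo_diskMobius (hc : c ∈ ball (0 : ℂ) 1) :
    MapsTo (diskMobius c) (ball 0 1) (ball 0 1) :=
  fun _ => diskMobius_mem_ball hc

lemma diskMobius_diskMobius_neg (hc : c ∈ ball (0 : ℂ) 1) (hw : w ∈ ball (0 : ℂ) 1) :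
    diskMobius c (diskMobius (-c) w) = w := by
  have hc' : -c ∈ ball (0 : ℂ) 1 := by simpa using hc
  have h₁ := one_add_conj_mul_ne_zero hc' hw
  have h₂ := one_add_conj_mul_ne_zero hc (diskMobius_mem_ball hc' hw)
  have h₃ : diskMobius (-c) w * (1 + conj (-c) * w) = w + -c := div_mul_cancel₀ _ h₁
  rw [diskMobius, div_eq_iff h₂]
  rw [map_neg] at h₁ h₃
  refine mul_right_cancel₀ h₁ ?_
  linear_combination (1 - conj c * w) * h₃

lemma hasDerivAt_one_add_conj_mul (c w : ℂ) :
    HasDerivAt (fun w => 1 + conj c * w) (conj c) w := by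
  simpa using ((hasDerivAt_id w).const_mul (conj c)).const_add 1

lemma hasDerivAt_diskMobius (hne : 1 + conj c * w ≠ 0) :
    HasDerivAt (diskMobius c) ((1 - (‖c‖ : ℂ) ^ 2) / (1 + conj c * w) ^ 2) w := by
  refine (((hasDerivAt_id w).add_const c).div (hasDerivAt_one_add_conj_mul c w) hne).congr_deriv ?_
  rw [← Complex.conj_mul', id]
  ring

lemma deriv_diskMobius (hne : 1 + conj c * w ≠ 0) :
    deriv (diskMobius c) w = (1 - (‖c‖ : ℂ) ^ 2) / (1 + conj c * w) ^ 2 :=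
  (hasDerivAt_diskMobius hne).deriv

lemma analyticAt_diskMobius (hne : 1 + conj c * w ≠ 0) : AnalyticAt ℂ (diskMobius c) w := by
  unfold diskMobius
  fun_prop (disch := assumption)

lemma differentiableOn_diskMobius (hc : c ∈ ball (0 : ℂ) 1) :
    DifferentiableOn ℂ (diskMobius c) (ball 0 1) := fun _ hw =>
  (analyticAt_diskMobius (one_add_conj_mul_ne_zero hc hw)).differentiableWithinAt

lemma eventually_one_add_conj_mul_ne_zero (hne : 1 + conj c * w ≠ 0) :
    ∀ᶠ w in 𝓝 w, 1 + conj c * w ≠ 0 :=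
  (by fun_prop : Continuous fun w => 1 + conj c * w).continuousAt.eventually_ne hne

lemma deriv_deriv_diskMobius (hne : 1 + conj c * w ≠ 0) :
    deriv (deriv (diskMobius c)) w
      = -2 * conj c * (1 - (‖c‖ : ℂ) ^ 2) / (1 + conj c * w) ^ 3 := by
  have hev : deriv (diskMobius c) =ᶠ[𝓝 w] fun w => (1 - (‖c‖ : ℂ) ^ 2) / (1 + conj c * w) ^ 2 :=
    (eventually_one_add_conj_mul_ne_zero hne).mono fun _ => deriv_diskMobius
  rw [hev.deriv_eq]
  refine ((hasDerivAt_const w _).fun_div ((hasDerivAt_one_add_conj_mul c w).fun_pow 2)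
    (pow_ne_zero 2 hne)).deriv.trans ?_
  field_simp
  ring

lemma one_sub_norm_sq_mul_norm_deriv_diskMobius (hc : c ∈ ball (0 : ℂ) 1)
    (hne : 1 + conj c * w ≠ 0) :
    (1 - ‖w‖ ^ 2) * ‖deriv (diskMobius c) w‖ = 1 - ‖diskMobius c w‖ ^ 2 := by
  have hnorm : ‖1 - (‖c‖ : ℂ) ^ 2‖ = 1 - ‖c‖ ^ 2 := by
    rw [show 1 - (‖c‖ : ℂ) ^ 2 = ((1 - ‖c‖ ^ 2 : ℝ) : ℂ) by push_cast; rfl,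
      Complex.norm_of_nonneg (one_sub_norm_sq_pos hc).le]
  rw [deriv_diskMobius hne, one_sub_norm_diskMobius_sq hne, norm_div, norm_pow, hnorm]
  ring

end DiskMobius

section Disconjugacy

variable {E : Type*} [NormedAddCommGroup E] [InnerProductSpace ℝ E]
  {y y₁ y₂ : ℝ → E} {p q : ℝ → ℝ} {a b x : ℝ}

open RealInnerProductSpace

lemma hasDerivAt_inner_add_mul_norm_sq (hy : HasDerivAt y (y₁ x) x)
    (hy₁ : HasDerivAt y₁ (y₂ x) x) (hp : HasDerivAt p (p x ^ 2 + q x) x) :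
    HasDerivAt (fun x => ⟪y x, y₁ x⟫ + p x * ‖y x‖ ^ 2)
      (‖y₁ x + p x • y x‖ ^ 2 + (q x * ‖y x‖ ^ 2 + ⟪y x, y₂ x⟫)) x := by
  refine ((hy.inner ℝ hy₁).add (hp.mul hy.norm_sq)).congr_deriv ?_
  rw [norm_add_sq_real, norm_smul, inner_smul_right, real_inner_self_eq_norm_sq, mul_pow,
    Real.norm_eq_abs, sq_abs, real_inner_comm (y x) (y₁ x)]
  ring

lemma mul_norm_sq_add_inner_nonneg {u v : E} {r : ℝ} (h : ‖v‖ ≤ r * ‖u‖) :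
    0 ≤ r * ‖u‖ ^ 2 + ⟪u, v⟫ := by
  have hinner : -(‖u‖ * ‖v‖) ≤ ⟪u, v⟫ := neg_le_of_abs_le (abs_real_inner_le_norm u v)
  nlinarith [mul_le_mul_of_nonneg_left h (norm_nonneg u)]

/-- The energy `⟪y, y'⟫ + p ‖y‖²` is monotone and vanishes at both ends, so it is constant. -/
theorem deriv_eq_zero_of_riccati (hab : a < b)
    (hy : ∀ x ∈ Icc a b, HasDerivAt y (y₁ x) x) (hy₁ : ∀ x ∈ Icc a b, HasDerivAt y₁ (y₂ x) x)
    (hp : ∀ x ∈ Icc a b, HasDerivAt p (p x ^ 2 + q x) x)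
    (hq : ∀ x ∈ Icc a b, ‖y₂ x‖ ≤ q x * ‖y x‖) (ha : y a = 0) (hb : y b = 0) :
    y₁ a = 0 := by
  have hderiv := fun x hx => hasDerivAt_inner_add_mul_norm_sq (hy x hx) (hy₁ x hx) (hp x hx)
  set energy : ℝ → ℝ := fun x => ⟪y x, y₁ x⟫ + p x * ‖y x‖ ^ 2 with henergy
  have hmono : MonotoneOn energy (Icc a b) := by
    refine monotoneOn_of_hasDerivWithinAt_nonneg (convex_Icc a b)
      (fun x hx => (hderiv x hx).continuousAt.continuousWithinAt)
      (fun x hx => (hderiv x (interior_subset hx)).hasDerivWithinAt) fun x hx => ?_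
    exact add_nonneg (sq_nonneg _) (mul_norm_sq_add_inner_nonneg (hq x (interior_subset hx)))
  have hla : a ∈ Icc a b := left_mem_Icc.2 hab.le
  have hrb : b ∈ Icc a b := right_mem_Icc.2 hab.le
  have hconst : ∀ x ∈ Icc a b, energy x = 0 := by
    have hza : energy a = 0 := by simp [henergy, ha]
    have hzb : energy b = 0 := by simp [henergy, hb]
    exact fun x hx => le_antisymm (hzb ▸ hmono hx hrb hx.2) (hza ▸ hmono hla hx hx.1)
  have hzero : HasDerivWithinAt energy 0 (Icc a b) a :=
    (hasDerivWithinAt_const a (Icc a b) (0 : ℝ)).congr hconst (hconst a hla)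
  have := (uniqueDiffOn_Icc hab a hla).eq_deriv _ (hderiv a hla).hasDerivWithinAt hzero
  simpa [ha] using this

lemma hasDerivAt_div_one_sub_sq (hx : 1 - x ^ 2 ≠ 0) :
    HasDerivAt (fun x => x / (1 - x ^ 2))
      ((x / (1 - x ^ 2)) ^ 2 + ((1 - x ^ 2) ^ 2)⁻¹) x := by
  have hden : HasDerivAt (fun x : ℝ => 1 - x ^ 2) (-(2 * x)) x := by
    simpa using ((hasDerivAt_id x).pow 2).const_sub 1
  refine ((hasDerivAt_id x).div hden hx).congr_deriv ?_
  simp only [id]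
  field_simp
  ring

theorem deriv_zero_eq_zero_of_norm_le (hb0 : 0 < b) (hb1 : b < 1)
    (hy : ∀ x ∈ Icc 0 b, HasDerivAt y (y₁ x) x) (hy₁ : ∀ x ∈ Icc 0 b, HasDerivAt y₁ (y₂ x) x)
    (hq : ∀ x ∈ Icc 0 b, (1 - x ^ 2) ^ 2 * ‖y₂ x‖ ≤ ‖y x‖) (h0 : y 0 = 0) (hb : y b = 0) :
    y₁ 0 = 0 := by
  have hpos : ∀ x ∈ Icc 0 b, 0 < 1 - x ^ 2 := fun x hx => by nlinarith [hx.1, hx.2]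
  refine deriv_eq_zero_of_riccati hb0 hy hy₁
    (fun x hx => hasDerivAt_div_one_sub_sq (hpos x hx).ne') (fun x hx => ?_) h0 hb
  have := pow_pos (hpos x hx) 2
  rw [inv_mul_eq_div, le_div_iff₀' this]
  exact hq x hx

end Disconjugacy

section HoloSchwarzian

/-- The Schwarzian derivative `(φ''/φ')' - (φ''/φ')² / 2` of a holomorphic function, written with
the logarithmic derivative of `φ'` so as to match `schwarzian`. -/
noncomputable def holoSchwarzian (φ : ℂ → ℂ) (z : ℂ) : ℂ :=
  deriv (logDeriv (deriv φ)) z - 1 / 2 * logDeriv (deriv φ) z ^ 2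

variable {φ ψ : ℂ → ℂ} {c z : ℂ}

lemma analyticAt_logDeriv_deriv (hφ : AnalyticAt ℂ φ z) (h0 : deriv φ z ≠ 0) :
    AnalyticAt ℂ (logDeriv (deriv φ)) z :=
  hφ.deriv.deriv.div hφ.deriv h0

lemma holoSchwarzian_eq (hφ : AnalyticAt ℂ φ z) (h0 : deriv φ z ≠ 0) :
    holoSchwarzian φ z = deriv (deriv (deriv φ)) z / deriv φ z
      - 3 / 2 * (deriv (deriv φ) z / deriv φ z) ^ 2 := by
  have h₁ := hφ.deriv.differentiableAt
  have h₂ := hφ.deriv.deriv.differentiableAt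
  rw [holoSchwarzian, logDeriv_apply, logDeriv, deriv_div h₂ h₁ h0]
  field_simp
  ring

lemma logDeriv_deriv_comp (hφ : AnalyticAt ℂ φ (ψ z)) (hψ : AnalyticAt ℂ ψ z)
    (hφ0 : deriv φ (ψ z) ≠ 0) (hψ0 : deriv ψ z ≠ 0) :
    logDeriv (deriv (φ ∘ ψ)) z
      = logDeriv (deriv φ) (ψ z) * deriv ψ z + logDeriv (deriv ψ) z := by
  have hev : deriv (φ ∘ ψ) =ᶠ[𝓝 z] fun w => (deriv φ ∘ ψ) w * deriv ψ w := by
    filter_upwards [hψ.continuousAt.eventually hφ.eventually_analyticAt,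
      hψ.eventually_analyticAt] with w hφw hψw
    exact deriv_comp w hφw.differentiableAt hψw.differentiableAt
  rw [(logDeriv_congr_nhds hev).eq_of_nhds, logDeriv_mul (f := deriv φ ∘ ψ) z hφ0 hψ0
      (hφ.deriv.differentiableAt.comp z hψ.differentiableAt) hψ.deriv.differentiableAt,
    logDeriv_comp hφ.deriv.differentiableAt hψ.differentiableAt]

lemma holoSchwarzian_comp (hφ : AnalyticAt ℂ φ (ψ z)) (hψ : AnalyticAt ℂ ψ z)
    (hφ0 : deriv φ (ψ z) ≠ 0) (hψ0 : deriv ψ z ≠ 0) :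
    holoSchwarzian (φ ∘ ψ) z
      = holoSchwarzian φ (ψ z) * deriv ψ z ^ 2 + holoSchwarzian ψ z := by
  have hev : logDeriv (deriv (φ ∘ ψ)) =ᶠ[𝓝 z]
      fun w => logDeriv (deriv φ) (ψ w) * deriv ψ w + logDeriv (deriv ψ) w := by
    filter_upwards [hψ.continuousAt.eventually hφ.eventually_analyticAt,
      hψ.continuousAt.eventually (hφ.deriv.continuousAt.eventually_ne hφ0),
      hψ.eventually_analyticAt, hψ.deriv.continuousAt.eventually_ne hψ0] with w h₁ h₂ h₃ h₄
    exact logDeriv_deriv_comp h₁ h₃ h₂ h₄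
  have hP := (analyticAt_logDeriv_deriv hφ hφ0).differentiableAt.hasDerivAt.comp z
    hψ.differentiableAt.hasDerivAt
  have hQ := (analyticAt_logDeriv_deriv hψ hψ0).differentiableAt.hasDerivAt
  have hderiv := ((hP.mul hψ.deriv.differentiableAt.hasDerivAt).add hQ).deriv
  rw [holoSchwarzian, hev.deriv_eq, hev.self_of_nhds]
  refine (congrArg (· - _) hderiv).trans ?_
  simp only [holoSchwarzian, logDeriv_apply (deriv ψ) z, Function.comp_apply]
  field_simp
  ring

lemma deriv_diskMobius_ne_zero (hc : c ∈ ball (0 : ℂ) 1) (hz : z ∈ ball (0 : ℂ) 1) :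
    deriv (diskMobius c) z ≠ 0 := by
  rw [deriv_diskMobius (one_add_conj_mul_ne_zero hc hz)]
  have hc' : 1 - (‖c‖ : ℂ) ^ 2 ≠ 0 := by exact_mod_cast (one_sub_norm_sq_pos hc).ne'
  exact div_ne_zero hc' (pow_ne_zero 2 (one_add_conj_mul_ne_zero hc hz))

lemma holoSchwarzian_diskMobius (hc : c ∈ ball (0 : ℂ) 1) (hz : z ∈ ball (0 : ℂ) 1) :
    holoSchwarzian (diskMobius c) z = 0 := by
  have hc0 : 1 - (‖c‖ : ℂ) ^ 2 ≠ 0 := by exact_mod_cast (one_sub_norm_sq_pos hc).ne'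
  have hne := one_add_conj_mul_ne_zero hc hz
  have hev : logDeriv (deriv (diskMobius c)) =ᶠ[𝓝 z] fun w => -2 * conj c / (1 + conj c * w) := by
    filter_upwards [eventually_one_add_conj_mul_ne_zero hne] with w hw
    rw [logDeriv_apply, deriv_deriv_diskMobius hw, deriv_diskMobius hw]
    field_simp
  rw [holoSchwarzian, hev.deriv_eq, hev.self_of_nhds,
    ((hasDerivAt_const z (-2 * conj c)).fun_div (hasDerivAt_one_add_conj_mul c z) hne).deriv]
  field_simp
  ring

lemma one_sub_norm_sq_mul_norm_holoSchwarzian_comp_diskMobius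
    (hφ : DifferentiableOn ℂ φ (ball 0 1)) (h0 : ∀ z ∈ ball (0 : ℂ) 1, deriv φ z ≠ 0)
    (hc : c ∈ ball (0 : ℂ) 1) (hz : z ∈ ball (0 : ℂ) 1) :
    (1 - ‖z‖ ^ 2) ^ 2 * ‖holoSchwarzian (φ ∘ diskMobius c) z‖
      = (1 - ‖diskMobius c z‖ ^ 2) ^ 2 * ‖holoSchwarzian φ (diskMobius c z)‖ := by
  have hcz := diskMobius_mem_ball hc hz
  have hne := one_add_conj_mul_ne_zero hc hz
  rw [holoSchwarzian_comp (hφ.analyticAt (isOpen_ball.mem_nhds hcz)) (analyticAt_diskMobius hne)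
      (h0 _ hcz) (deriv_diskMobius_ne_zero hc hz), holoSchwarzian_diskMobius hc hz, add_zero,
    norm_mul, norm_pow, ← one_sub_norm_sq_mul_norm_deriv_diskMobius hc hne]
  ring

end HoloSchwarzian

section Nehari

variable {φ : ℂ → ℂ} {a c z : ℂ} {r : ℝ}

/-- With `Λ` a logarithm of `φ'`, the function `u = (φ - φ a) exp (-Λ / 2)` solves
`u'' + (S / 2) u = 0`. -/
lemma exists_hasDerivAt_of_deriv_ne_zero (hφ : DifferentiableOn ℂ φ (ball c r))
    (h0 : ∀ z ∈ ball c r, deriv φ z ≠ 0) (ha : a ∈ ball c r) :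
    ∃ u u₁ : ℂ → ℂ, (∀ z ∈ ball c r, HasDerivAt u (u₁ z) z) ∧
      (∀ z ∈ ball c r, HasDerivAt u₁ (-(holoSchwarzian φ z / 2) * u z) z) ∧
      (∀ z, u z = 0 ↔ φ z = φ a) ∧ u₁ a ≠ 0 := by
  have hφan : ∀ z ∈ ball c r, AnalyticAt ℂ φ z := fun z hz =>
    hφ.analyticAt (isOpen_ball.mem_nhds hz)
  set p : ℂ → ℂ := logDeriv (deriv φ) with hp
  have hpan : ∀ z ∈ ball c r, AnalyticAt ℂ p z := fun z hz =>
    analyticAt_logDeriv_deriv (hφan z hz) (h0 z hz)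
  have hp' : ∀ z ∈ ball c r, HasDerivAt p (holoSchwarzian φ z + 1 / 2 * p z ^ 2) z :=
    fun z hz => (hpan z hz).differentiableAt.hasDerivAt.congr_deriv (by simp [holoSchwarzian, hp])
  have hφ' : ∀ z ∈ ball c r, HasDerivAt (deriv φ) (p z * deriv φ z) z := fun z hz =>
    (hφan z hz).deriv.differentiableAt.hasDerivAt.congr_deriv
      (by rw [hp, logDeriv_apply, div_mul_cancel₀ _ (h0 z hz)])
  have hφa : ∀ z ∈ ball c r, HasDerivAt (fun z => φ z - φ a) (deriv φ z) z := fun z hz =>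
    (hφan z hz).differentiableAt.hasDerivAt.sub_const _
  obtain ⟨Λ, hΛ⟩ := DifferentiableOn.isExactOn_ball
    fun z hz => (hpan z hz).differentiableWithinAt
  have hexp : ∀ z ∈ ball c r, HasDerivAt (fun z => Complex.exp (-Λ z / 2))
      (-(p z / 2) * Complex.exp (-Λ z / 2)) z := fun z hz =>
    ((hΛ z hz).neg.div_const 2).cexp.congr_deriv (by simp only [Pi.neg_apply]; ring)
  refine ⟨fun z => (φ z - φ a) * Complex.exp (-Λ z / 2),
    fun z => (deriv φ z - (φ z - φ a) * (p z / 2)) * Complex.exp (-Λ z / 2),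
    fun z hz => ?_, fun z hz => ?_, fun z => ?_, ?_⟩
  · exact ((hφa z hz).mul (hexp z hz)).congr_deriv (by ring)
  · exact (((hφ' z hz).fun_sub ((hφa z hz).fun_mul ((hp' z hz).div_const 2))).fun_mul
      (hexp z hz)).congr_deriv (by ring)
  · simp [Complex.exp_ne_zero, sub_eq_zero]
  · simpa [Complex.exp_ne_zero] using h0 a ha

lemma eq_zero_of_norm_holoSchwarzian_le (hφ : DifferentiableOn ℂ φ (ball 0 1))
    (h0 : ∀ z ∈ ball (0 : ℂ) 1, deriv φ z ≠ 0)
    (hS : ∀ z ∈ ball (0 : ℂ) 1, (1 - ‖z‖ ^ 2) ^ 2 * ‖holoSchwarzian φ z‖ ≤ 2)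
    (hz : z ∈ ball (0 : ℂ) 1) (heq : φ z = φ 0) : z = 0 := by
  by_contra hz0
  have hzpos : 0 < ‖z‖ := norm_pos_iff.2 hz0
  obtain ⟨u, u₁, hu, hu₁, huz, hu0⟩ :=
    exists_hasDerivAt_of_deriv_ne_zero hφ h0 (mem_ball_self one_pos)
  set e : ℂ := z / ‖z‖ with he
  have he1 : ‖e‖ = 1 := by simp [he, hzpos.ne']
  have hnorm : ∀ x ∈ Icc 0 ‖z‖, ‖(x : ℂ) * e‖ = x := fun x hx => by
    rw [norm_mul, he1, mul_one, Complex.norm_of_nonneg hx.1]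
  have hmem : ∀ x ∈ Icc 0 ‖z‖, (x : ℂ) * e ∈ ball (0 : ℂ) 1 := fun x hx => by
    rw [mem_ball_zero_iff, hnorm x hx]
    exact hx.2.trans_lt (mem_ball_zero_iff.1 hz)
  have hray : ∀ x : ℝ, HasDerivAt (fun x : ℝ => (x : ℂ) * e) e x := fun x => by
    simpa using (Complex.ofRealCLM.hasDerivAt (x := x)).mul_const e
  have hu0' : u₁ 0 * e = 0 := by
    have := deriv_zero_eq_zero_of_norm_le (y := fun x : ℝ => u (x * e))
      (y₁ := fun x : ℝ => u₁ (x * e) * e)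
      (y₂ := fun x : ℝ => -(holoSchwarzian φ (x * e) / 2) * u (x * e) * e * e)
      hzpos (mem_ball_zero_iff.1 hz) (fun x hx => (hu _ (hmem x hx)).comp x (hray x))
      (fun x hx => ((hu₁ _ (hmem x hx)).comp x (hray x)).mul_const e) (fun x hx => ?_) ?_ ?_
    · simpa using this
    · have hSx := hS _ (hmem x hx)
      rw [hnorm x hx] at hSx
      simp only [norm_mul, norm_neg, norm_div, he1, mul_one, Complex.norm_ofNat]
      nlinarith [norm_nonneg (u (x * e))]
    · simp [huz]
    · have hend : (‖z‖ : ℂ) * e = z :=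
        mul_div_cancel₀ _ (Complex.ofReal_ne_zero.2 hzpos.ne')
      rw [hend, huz, heq]
  have he0 : e ≠ 0 := norm_pos_iff.1 (he1 ▸ one_pos)
  exact mul_ne_zero hu0 he0 hu0'

theorem injOn_of_norm_holoSchwarzian_le (hφ : DifferentiableOn ℂ φ (ball 0 1))
    (h0 : ∀ z ∈ ball (0 : ℂ) 1, deriv φ z ≠ 0)
    (hS : ∀ z ∈ ball (0 : ℂ) 1, (1 - ‖z‖ ^ 2) ^ 2 * ‖holoSchwarzian φ z‖ ≤ 2) :
    InjOn φ (ball 0 1) := by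
  intro c hc z hz heq
  have hc' : -c ∈ ball (0 : ℂ) 1 := by simpa using hc
  set w := diskMobius (-c) z
  have hcw : diskMobius c w = z := diskMobius_diskMobius_neg hc hz
  have hw0 : w = 0 := by
    refine eq_zero_of_norm_holoSchwarzian_le (φ := φ ∘ diskMobius c)
      (hφ.comp (differentiableOn_diskMobius hc) (mapsTo_diskMobius hc)) (fun ζ hζ => ?_)
      (fun ζ hζ => ?_) (diskMobius_mem_ball hc' hz) ?_
    · have hcζ := diskMobius_mem_ball hc hζ
      rw [deriv_comp ζ (hφ.differentiableAt (isOpen_ball.mem_nhds hcζ))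
        ((differentiableOn_diskMobius hc).differentiableAt (isOpen_ball.mem_nhds hζ))]
      exact mul_ne_zero (h0 _ hcζ) (deriv_diskMobius_ne_zero hc hζ)
    · rw [one_sub_norm_sq_mul_norm_holoSchwarzian_comp_diskMobius hφ h0 hc hζ]
      exact hS _ (diskMobius_mem_ball hc hζ)
    · simp [hcw, heq]
  rw [← hcw, hw0, diskMobius_zero]

end Nehari

section SchwarzPick

variable {ω χ f g : ℂ → ℂ} {c z : ℂ}

lemma deriv_deriv_comp (hf : AnalyticAt ℂ f (g z)) (hg : AnalyticAt ℂ g z) :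
    deriv (deriv (f ∘ g)) z
      = deriv (deriv f) (g z) * deriv g z ^ 2 + deriv f (g z) * deriv (deriv g) z := by
  have hev : deriv (f ∘ g) =ᶠ[𝓝 z] fun w => (deriv f ∘ g) w * deriv g w := by
    filter_upwards [hg.continuousAt.eventually hf.eventually_analyticAt,
      hg.eventually_analyticAt] with w hfw hgw
    exact deriv_comp w hfw.differentiableAt hgw.differentiableAt
  rw [hev.deriv_eq, deriv_fun_mul (hf.deriv.differentiableAt.comp z hg.differentiableAt)
    hg.deriv.differentiableAt, deriv_comp z hf.deriv.differentiableAt hg.differentiableAt]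
  simp only [Function.comp_apply]
  ring

/-- The self-map `ω` of the unit disk recentred at `c`: both `c` and `ω c` are moved to the origin
by automorphisms of the disk. -/
noncomputable def recentre (ω : ℂ → ℂ) (c : ℂ) : ℂ → ℂ :=
  diskMobius (-ω c) ∘ ω ∘ diskMobius c

/-- The second-order analogue of `hyperbolicDeriv`: the second derivative at the origin of
`recentre ω z`. -/
noncomputable def secondHyperbolicDeriv (ω : ℂ → ℂ) (z : ℂ) : ℂ :=
  ((1 - (‖z‖ : ℂ) ^ 2) ^ 2
      * (deriv (deriv ω) z + 2 * conj (ω z) * deriv ω z ^ 2 / (1 - (‖ω z‖ : ℂ) ^ 2))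
    - 2 * conj z * (1 - (‖z‖ : ℂ) ^ 2) * deriv ω z) / (1 - (‖ω z‖ : ℂ) ^ 2)

@[simp]
lemma recentre_zero (ω : ℂ → ℂ) (c : ℂ) : recentre ω c 0 = 0 := by
  simp [recentre]

lemma mapsTo_recentre (hb : MapsTo ω (ball 0 1) (ball 0 1)) (hc : c ∈ ball (0 : ℂ) 1) :
    MapsTo (recentre ω c) (ball 0 1) (ball 0 1) :=
  (mapsTo_diskMobius (by simpa using hb hc)).comp (hb.comp (mapsTo_diskMobius hc))

lemma differentiableOn_recentre (hω : DifferentiableOn ℂ ω (ball 0 1))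
    (hb : MapsTo ω (ball 0 1) (ball 0 1)) (hc : c ∈ ball (0 : ℂ) 1) :
    DifferentiableOn ℂ (recentre ω c) (ball 0 1) :=
  (differentiableOn_diskMobius (by simpa using hb hc)).comp
    (hω.comp (differentiableOn_diskMobius hc) (mapsTo_diskMobius hc))
    (hb.comp (mapsTo_diskMobius hc))

lemma deriv_recentre_zero (hω : AnalyticAt ℂ ω c) (hωc : ω c ∈ ball (0 : ℂ) 1) :
    deriv (recentre ω c) 0 = hyperbolicDeriv ω c := by
  have hne : 1 - (‖ω c‖ : ℂ) ^ 2 ≠ 0 := by exact_mod_cast (one_sub_norm_sq_pos hωc).ne'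
  have hne' : 1 + conj (-ω c) * (ω ∘ diskMobius c) 0 ≠ 0 := by
    simpa [Complex.conj_mul', ← sub_eq_add_neg] using hne
  have hc := analyticAt_diskMobius (c := c) (w := 0) (by simp)
  have hω' : AnalyticAt ℂ ω (diskMobius c 0) := by simpa using hω
  rw [recentre, deriv_comp 0 (analyticAt_diskMobius hne').differentiableAt
    (hω'.comp hc).differentiableAt, deriv_comp 0 hω'.differentiableAt hc.differentiableAt,
    deriv_diskMobius hne', deriv_diskMobius (by simp)]
  simp only [Function.comp_apply, diskMobius_zero, hyperbolicDeriv, map_neg, neg_mul,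
    Complex.conj_mul', ← sub_eq_add_neg, norm_neg, mul_zero, add_zero]
  field_simp

lemma deriv_deriv_recentre_zero (hω : AnalyticAt ℂ ω c) (hωc : ω c ∈ ball (0 : ℂ) 1) :
    deriv (deriv (recentre ω c)) 0 = secondHyperbolicDeriv ω c := by
  have hne : 1 - (‖ω c‖ : ℂ) ^ 2 ≠ 0 := by exact_mod_cast (one_sub_norm_sq_pos hωc).ne'
  have hne' : 1 + conj (-ω c) * (ω ∘ diskMobius c) 0 ≠ 0 := by
    simpa [Complex.conj_mul', ← sub_eq_add_neg] using hne
  have hc := analyticAt_diskMobius (c := c) (w := 0) (by simp)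
  have hω' : AnalyticAt ℂ ω (diskMobius c 0) := by simpa using hω
  rw [recentre, deriv_deriv_comp (analyticAt_diskMobius hne') (hω'.comp hc),
    deriv_deriv_comp hω' hc, deriv_comp 0 hω'.differentiableAt hc.differentiableAt,
    deriv_diskMobius hne', deriv_deriv_diskMobius hne', deriv_diskMobius (by simp),
    deriv_deriv_diskMobius (by simp)]
  simp only [Function.comp_apply, diskMobius_zero, secondHyperbolicDeriv, map_neg, neg_mul,
    Complex.conj_mul', ← sub_eq_add_neg, norm_neg, mul_zero, add_zero]
  field_simp
  ring

theorem norm_hyperbolicDeriv_le_one (hω : DifferentiableOn ℂ ω (ball 0 1))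
    (hb : MapsTo ω (ball 0 1) (ball 0 1)) (hc : c ∈ ball (0 : ℂ) 1) :
    ‖hyperbolicDeriv ω c‖ ≤ 1 := by
  rw [← deriv_recentre_zero (hω.analyticAt (isOpen_ball.mem_nhds hc)) (hb hc)]
  refine Complex.norm_deriv_le_one_of_mapsTo_ball (differentiableOn_recentre hω hb hc) ?_ one_pos
  rw [recentre_zero]
  exact (mapsTo_recentre hb hc).mono_right ball_subset_closedBall

lemma norm_deriv_zero_le_one_sub_norm_sq (hχ : DifferentiableOn ℂ χ (ball 0 1))
    (hb : MapsTo χ (ball 0 1) (closedBall 0 1)) : ‖deriv χ 0‖ ≤ 1 - ‖χ 0‖ ^ 2 := by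
  have h0 : (0 : ℂ) ∈ ball (0 : ℂ) 1 := mem_ball_self one_pos
  by_cases hmax : ∃ z ∈ ball (0 : ℂ) 1, ‖χ z‖ = 1
  · obtain ⟨z, hz, hz1⟩ := hmax
    have hconst : EqOn χ (fun _ => χ z) (ball 0 1) :=
      Complex.eqOn_of_isPreconnected_of_isMaxOn_norm (convex_ball 0 1).isPreconnected
        isOpen_ball hχ hz fun w hw => by
          simpa only [mem_ofPred_eq, Function.comp_apply, hz1]
            using mem_closedBall_zero_iff.1 (hb hw)
    rw [(hconst.eventuallyEq_of_mem (isOpen_ball.mem_nhds h0)).deriv_eq, hconst h0]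
    simp [hz1]
  · have hopen : MapsTo χ (ball 0 1) (ball 0 1) := fun z hz => mem_ball_zero_iff.2 <|
      lt_of_le_of_ne (mem_closedBall_zero_iff.1 (hb hz)) fun h => hmax ⟨z, hz, h⟩
    have hpick := norm_hyperbolicDeriv_le_one hχ hopen h0
    have hpos := one_sub_norm_sq_pos (hopen h0)
    rw [hyperbolicDeriv, norm_div, show 1 - (‖χ 0‖ : ℂ) ^ 2 = ((1 - ‖χ 0‖ ^ 2 : ℝ) : ℂ) by simp,
      Complex.norm_of_nonneg hpos.le, div_le_one hpos] at hpick
    simpa using hpick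

/-- The second-order Schwarz lemma: `ω z / z` maps the disk to the closed disk, so the first-order
bound applies to it. -/
lemma norm_deriv_deriv_zero_le (hω : DifferentiableOn ℂ ω (ball 0 1))
    (hb : MapsTo ω (ball 0 1) (ball 0 1)) (h0 : ω 0 = 0) :
    ‖deriv (deriv ω) 0‖ ≤ 2 * (1 - ‖deriv ω 0‖ ^ 2) := by
  have hnhds : ball (0 : ℂ) 1 ∈ 𝓝 0 := ball_mem_nhds 0 one_pos
  have hχ : DifferentiableOn ℂ (dslope ω 0) (ball 0 1) :=
    (Complex.differentiableOn_dslope hnhds).2 hω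
  have hχb : MapsTo (dslope ω 0) (ball 0 1) (closedBall 0 1) := fun z hz => by
    simpa using Complex.norm_dslope_le_div_of_mapsTo_ball (R₂ := 1) hω
      (by rw [h0]; exact hb.mono_right ball_subset_closedBall) hz
  have hfac : ω = fun z => z * dslope ω 0 z := by
    funext z
    simpa [h0] using (sub_smul_dslope ω 0 z).symm
  have hder : deriv ω =ᶠ[𝓝 0] fun z => dslope ω 0 z + z * deriv (dslope ω 0) z := by
    filter_upwards [hnhds] with z hz
    conv_lhs => rw [hfac]
    simpa using deriv_fun_mul differentiableAt_fun_id
      (hχ.differentiableAt (isOpen_ball.mem_nhds hz))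
  have hder2 : deriv (deriv ω) 0 = 2 * deriv (dslope ω 0) 0 := by
    have hχ0 := hχ.differentiableAt hnhds
    have hχ1 := (hχ.deriv isOpen_ball).differentiableAt hnhds
    rw [hder.deriv_eq, deriv_fun_add hχ0 (differentiableAt_fun_id.fun_mul hχ1),
      deriv_fun_mul differentiableAt_fun_id hχ1]
    simp only [deriv_id'', one_mul, zero_mul, add_zero]
    ring
  have hpick := norm_deriv_zero_le_one_sub_norm_sq hχ hχb
  rw [dslope_same] at hpick
  rw [hder2, norm_mul, Complex.norm_ofNat]
  linarith

theorem norm_secondHyperbolicDeriv_le (hω : DifferentiableOn ℂ ω (ball 0 1))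
    (hb : MapsTo ω (ball 0 1) (ball 0 1)) (hc : c ∈ ball (0 : ℂ) 1) :
    ‖secondHyperbolicDeriv ω c‖ ≤ 2 * (1 - ‖hyperbolicDeriv ω c‖ ^ 2) := by
  have hωc := hω.analyticAt (isOpen_ball.mem_nhds hc)
  rw [← deriv_recentre_zero hωc (hb hc), ← deriv_deriv_recentre_zero hωc (hb hc)]
  exact norm_deriv_deriv_zero_le (differentiableOn_recentre hω hb hc) (mapsTo_recentre hb hc)
    (recentre_zero ω c)

end SchwarzPick

section Lewy

variable {f h g k l p q K : ℂ → ℂ} {c : ℂ}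

lemma norm_lt_of_eventually_norm_lt {r : ℝ} (hf : AnalyticAt ℂ f c)
    (hlt : ∀ᶠ z in 𝓝[≠] c, ‖f z‖ < r) : ‖f c‖ < r := by
  have hle : ‖f c‖ ≤ r := le_of_tendsto
    (hf.continuousAt.norm.tendsto.mono_left nhdsWithin_le_nhds) (hlt.mono fun _ h => h.le)
  refine hle.lt_of_ne fun heq => ?_
  have hmax : IsLocalMax (norm ∘ f) c := by
    filter_upwards [eventually_nhdsWithin_iff.1 hlt] with z hz
    rcases eq_or_ne z c with rfl | hzc
    · exact le_rfl
    · exact (hz hzc).le.trans_eq heq.symm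
  have hconst := Complex.norm_eventually_eq_of_isLocalMax
    (hf.eventually_analyticAt.mono fun z hz => hz.differentiableAt) hmax
  obtain ⟨z, hz_eq, hz_lt⟩ := ((hconst.filter_mono nhdsWithin_le_nhds).and hlt).exists
  exact hz_lt.ne (hz_eq.trans heq)

lemma exists_analyticAt_eventuallyEq_mul_of_norm_lt (hp : AnalyticAt ℂ p c)
    (hq : AnalyticAt ℂ q c) (hlt : ∀ᶠ z in 𝓝[≠] c, ‖q z‖ < ‖p z‖) :
    ∃ ω : ℂ → ℂ, AnalyticAt ℂ ω c ∧ ‖ω c‖ < 1 ∧ ∀ᶠ z in 𝓝 c, q z = ω z * p z := by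
  obtain ⟨s, hs, hsub⟩ := mem_nhdsWithin_iff_exists_mem_nhds_inter.1
    (hlt.and ((hp.eventually_analyticAt.and hq.eventually_analyticAt).filter_mono
      nhdsWithin_le_nhds))
  have hlt_s : ∀ z ∈ s \ {c}, ‖q z / p z‖ < 1 := fun z hz => by
    have hz' := (hsub hz).1
    rw [norm_div]
    exact (div_lt_one ((norm_nonneg _).trans_lt hz')).2 hz'
  have hp0 : ∀ z ∈ s \ {c}, p z ≠ 0 := fun z hz =>
    norm_pos_iff.1 ((norm_nonneg _).trans_lt (hsub hz).1)
  have hd : DifferentiableOn ℂ (fun z => q z / p z) (s \ {c}) := fun z hz =>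
    ((hsub hz).2.2.differentiableAt.fun_div (hsub hz).2.1.differentiableAt
      (hp0 z hz)).differentiableWithinAt
  set ω := Function.update (fun z => q z / p z) c (limUnder (𝓝[≠] c) fun z => q z / p z)
  have hωs : DifferentiableOn ℂ ω s :=
    Complex.differentiableOn_update_limUnder_of_bddAbove hs hd
      ⟨1, by rintro _ ⟨z, hz, rfl⟩; exact (hlt_s z hz).le⟩
  have hω : AnalyticAt ℂ ω c := hωs.analyticAt hs
  have hs' : s \ {c} ∈ 𝓝[≠] c := sdiff_mem_nhdsWithin_compl hs {c}
  have hω_eq : ∀ z ∈ s \ {c}, ω z = q z / p z := fun z hz => Function.update_of_ne hz.2 _ _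
  have hω_lt : ∀ᶠ z in 𝓝[≠] c, ‖ω z‖ < 1 := by
    filter_upwards [hs'] with z hz using hω_eq z hz ▸ hlt_s z hz
  refine ⟨ω, hω, norm_lt_of_eventually_norm_lt hω hω_lt,
    (hq.continuousAt.eventuallyEq_nhds_iff_eventuallyEq_nhdsNE (hω.mul hp).continuousAt).1 ?_⟩
  filter_upwards [hs'] with z hz
  rw [Pi.mul_apply, hω_eq z hz, div_mul_cancel₀ _ (hp0 z hz)]

lemma eventually_deriv_eq_pow_mul {n : ℕ} (hk : AnalyticAt ℂ k c)
    (hf : ∀ᶠ z in 𝓝 c, f z - f c = (z - c) ^ (n + 1) * k z) :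
    ∀ᶠ z in 𝓝 c, deriv f z = (z - c) ^ n * ((n + 1) * k z + (z - c) * deriv k z) := by
  filter_upwards [hf.eventually_nhds, hk.eventually_analyticAt] with z hz hkz
  have hfz : f =ᶠ[𝓝 z] fun w => f c + (w - c) ^ (n + 1) * k w :=
    hz.mono fun w hw => by linear_combination hw
  rw [hfz.deriv_eq]
  refine (((((hasDerivAt_id' z).sub_const c).fun_pow (n + 1)).fun_mul
    hkz.differentiableAt.hasDerivAt).const_add (f c)).deriv.trans ?_
  rw [Nat.add_sub_cancel]
  push_cast
  ring

lemma exists_sub_eq_pow_mul_of_deriv_eq {n : ℕ} (hf : AnalyticAt ℂ f c) (hK : AnalyticAt ℂ K c)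
    (hd : ∀ᶠ z in 𝓝 c, deriv f z = (z - c) ^ n * K z) :
    ∃ k : ℂ → ℂ, AnalyticAt ℂ k c ∧ (n + 1) * k c = K c ∧
      ∀ᶠ z in 𝓝 c, f z - f c = (z - c) ^ (n + 1) * k z := by
  have horder : ((n + 1 : ℕ) : ℕ∞) ≤ analyticOrderAt (f · - f c) c := by
    rw [← hf.analyticOrderAt_deriv_add_one]
    push_cast
    gcongr
    exact (natCast_le_analyticOrderAt hf.deriv).2 ⟨K, hK, hd⟩
  obtain ⟨k, hk, hfk⟩ := (natCast_le_analyticOrderAt (hf.sub analyticAt_const)).1 horder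
  refine ⟨k, hk, ?_, hfk⟩
  have hK_eq : ∀ᶠ z in 𝓝[≠] c, (n + 1) * k z + (z - c) * deriv k z = K z := by
    filter_upwards [(eventually_deriv_eq_pow_mul hk hfk).filter_mono nhdsWithin_le_nhds,
      hd.filter_mono nhdsWithin_le_nhds, self_mem_nhdsWithin] with z hz hz' hzc
    exact mul_left_cancel₀ (pow_ne_zero n (sub_ne_zero.2 hzc)) (hz.symm.trans hz')
  have hcont : ContinuousAt (fun z => (n + 1) * k z + (z - c) * deriv k z) c :=
    (continuousAt_const.mul hk.continuousAt).add
      ((continuousAt_id.sub continuousAt_const).mul hk.deriv.continuousAt)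
  have := ((hcont.eventuallyEq_nhds_iff_eventuallyEq_nhdsNE hK.continuousAt).1
    hK_eq).self_of_nhds
  simpa using this

lemma exists_sub_eq_pow_mul_of_deriv_eq_zero (hh : AnalyticAt ℂ h c) (hg : AnalyticAt ℂ g c)
    (hlt : ∀ᶠ z in 𝓝[≠] c, ‖deriv g z‖ < ‖deriv h z‖) (h0 : deriv h c = 0) :
    ∃ (N : ℕ) (k l : ℂ → ℂ), 2 ≤ N ∧ AnalyticAt ℂ k c ∧ AnalyticAt ℂ l c ∧ ‖l c‖ < ‖k c‖ ∧
      (∀ᶠ z in 𝓝 c, h z - h c = (z - c) ^ N * k z) ∧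
      ∀ᶠ z in 𝓝 c, g z - g c = (z - c) ^ N * l z := by
  obtain ⟨ω, hω, hω_lt, hgω⟩ :=
    exists_analyticAt_eventuallyEq_mul_of_norm_lt hh.deriv hg.deriv hlt
  have hne : ¬ ∀ᶠ z in 𝓝 c, deriv h z = 0 := fun hz => by
    obtain ⟨z, hz, hz'⟩ := ((hz.filter_mono nhdsWithin_le_nhds).and hlt).exists
    exact (norm_nonneg _).not_gt (by simpa only [hz, norm_zero] using hz')
  obtain ⟨n, K, hK, hK0, hhK⟩ := hh.deriv.exists_eventuallyEq_pow_smul_nonzero_iff.2 hne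
  have hn : n ≠ 0 := by
    rintro rfl
    exact hK0 (by simpa [h0] using hhK.self_of_nhds.symm)
  obtain ⟨k, hk, hkK, hhk⟩ := exists_sub_eq_pow_mul_of_deriv_eq hh hK hhK
  obtain ⟨l, hl, hlK, hgl⟩ := exists_sub_eq_pow_mul_of_deriv_eq (n := n) hg (hω.mul hK) <| by
    filter_upwards [hgω, hhK] with z hz hz'
    rw [hz, hz', Pi.mul_apply, smul_eq_mul]
    ring
  refine ⟨n + 1, k, l, by omega, hk, hl, ?_, hhk, hgl⟩
  have hn' : (n : ℂ) + 1 ≠ 0 := n.cast_add_one_ne_zero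
  have hlk : l c = ω c * k c := mul_left_cancel₀ hn' <| by
    rw [hlK, Pi.mul_apply, ← hkK]
    ring
  have hk0 : k c ≠ 0 := right_ne_zero_of_mul (hkK.trans_ne hK0)
  rw [hlk, norm_mul]
  exact mul_lt_of_lt_one_left (norm_pos_iff.2 hk0) hω_lt

lemma isInvertible_smul_id_add_conjCLE_comp {a b : ℂ} (hab : ‖b‖ < ‖a‖) :
    (a • ContinuousLinearMap.id ℝ ℂ + (Complex.conjCLE : ℂ →L[ℝ] ℂ) ∘L
      (b • ContinuousLinearMap.id ℝ ℂ)).IsInvertible := by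
  set T := a • ContinuousLinearMap.id ℝ ℂ + (Complex.conjCLE : ℂ →L[ℝ] ℂ) ∘L
      (b • ContinuousLinearMap.id ℝ ℂ)
  have hT : ∀ w, T w = a * w + conj (b * w) := fun w => by simp [T]
  have hinj : Function.Injective T := by
    refine (injective_iff_map_eq_zero T).2 fun w hw => by_contra fun hw0 => ?_
    rw [hT, add_eq_zero_iff_eq_neg] at hw
    have hnorm := congrArg norm hw
    rw [norm_neg, Complex.norm_conj, norm_mul, norm_mul] at hnorm
    exact hab.ne' (mul_right_cancel₀ (norm_ne_zero_iff.2 hw0) hnorm)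
  exact ⟨(LinearEquiv.ofInjectiveEndo (T : ℂ →ₗ[ℝ] ℂ) hinj).toContinuousLinearEquiv, rfl⟩

/-- The map `z ↦ (z - c) ^ N * k z + conj ((z - c) ^ N * l z)` in the coordinates `z = c + t * ζ`,
divided by `t ^ N`; the division makes it smooth up to `t = 0`. The argument is `(t, ζ)`. -/
def blowUp (N : ℕ) (k l : ℂ → ℂ) (c : ℂ) (q : ℝ × ℂ) : ℂ :=
  q.2 ^ N * k (c + q.1 * q.2) + conj (q.2 ^ N * l (c + q.1 * q.2))

lemma pow_mul_blowUp (N : ℕ) (k l : ℂ → ℂ) (c : ℂ) (t : ℝ) (ζ : ℂ) :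
    (t : ℂ) ^ N * blowUp N k l c (t, ζ)
      = (t * ζ) ^ N * k (c + t * ζ) + conj ((t * ζ) ^ N * l (c + t * ζ)) := by
  simp only [blowUp, map_mul, map_pow, Complex.conj_ofReal]
  ring

lemma contDiffAt_blowUp (hk : AnalyticAt ℂ k c) (hl : AnalyticAt ℂ l c) (N : ℕ) (ζ : ℂ) :
    ContDiffAt ℝ 1 (blowUp N k l c) (0, ζ) := by
  have hcoord : ContDiff ℝ 1 fun q : ℝ × ℂ => c + (q.1 : ℂ) * q.2 :=
    contDiff_const.add ((Complex.ofRealCLM.contDiff.comp contDiff_fst).mul contDiff_snd)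
  have hcomp : ∀ {m : ℂ → ℂ}, AnalyticAt ℂ m c →
      ContDiffAt ℝ 1 (fun q : ℝ × ℂ => m (c + (q.1 : ℂ) * q.2)) (0, ζ) := fun {m} hm => by
    have hm' : ContDiffAt ℝ 1 m (c + ((0 : ℝ) : ℂ) * ζ) := by
      simpa using (hm.contDiffAt (n := 1)).restrict_scalars ℝ
    exact hm'.comp (0, ζ) hcoord.contDiffAt
  have hpow : ContDiffAt ℝ 1 (fun q : ℝ × ℂ => q.2 ^ N) (0, ζ) := contDiffAt_snd.pow N
  exact (hpow.mul (hcomp hk)).add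
    (Complex.conjCLE.contDiff.contDiffAt.comp (0, ζ) (hpow.mul (hcomp hl)))

lemma hasFDerivAt_blowUp_zero_left (N : ℕ) (k l : ℂ → ℂ) (c ζ : ℂ) :
    HasFDerivAt (fun ζ => blowUp N k l c (0, ζ))
      ((N * ζ ^ (N - 1) * k c) • ContinuousLinearMap.id ℝ ℂ + (Complex.conjCLE : ℂ →L[ℝ] ℂ) ∘L
        ((N * ζ ^ (N - 1) * l c) • ContinuousLinearMap.id ℝ ℂ)) ζ := by
  have hpow : ∀ m : ℂ, HasFDerivAt (fun ζ : ℂ => ζ ^ N * m)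
      ((N * ζ ^ (N - 1) * m) • ContinuousLinearMap.id ℝ ℂ) ζ := fun m =>
    (((hasDerivAt_pow N ζ).mul_const m).hasFDerivAt.restrictScalars ℝ).congr_fderiv
      (by ext1; simp [mul_comm])
  have hsum := (hpow (k c)).add (Complex.conjCLE.hasFDerivAt.comp ζ (hpow (l c)))
  exact hsum.congr_of_eventuallyEq (.of_forall fun ζ => by simp [blowUp])

/-- At `t = 0` the equation `blowUp (t, ζ) = blowUp (t, 1)` is solved by every `N`-th root of unity,
and there its `ζ`-derivative is invertible because `‖l c‖ < ‖k c‖`. -/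
lemma exists_tendsto_blowUp_eq {N : ℕ} (hk : AnalyticAt ℂ k c) (hl : AnalyticAt ℂ l c)
    (hkl : ‖l c‖ < ‖k c‖) (hN : N ≠ 0) {η : ℂ} (hη : η ^ N = 1) :
    ∃ ψ : ℝ → ℂ, Tendsto ψ (𝓝 0) (𝓝 η) ∧
      ∀ᶠ t in 𝓝 0, blowUp N k l c (t, ψ t) = blowUp N k l c (t, 1) := by
  set G : ℝ × ℂ → ℂ := fun q => blowUp N k l c q - blowUp N k l c (q.1, 1)
  have hG_contDiff : ContDiffAt ℝ 1 G (0, η) :=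
    (contDiffAt_blowUp hk hl N η).sub (ContDiffAt.comp (0, η) (contDiffAt_blowUp hk hl N 1)
      (contDiffAt_fst.prodMk contDiffAt_const))
  have hG : HasStrictFDerivAt G (fderiv ℝ G (0, η)) (0, η) :=
    hG_contDiff.hasStrictFDerivAt one_ne_zero
  have hη0 : η ≠ 0 := fun h => by simp [h, hN] at hη
  have hinv : (fderiv ℝ G (0, η) ∘L .inr ℝ ℝ ℂ).IsInvertible := by
    have hslice := hG.hasFDerivAt.comp η (hasFDerivAt_prodMk_right (0 : ℝ) η)
    rw [hslice.unique
      ((hasFDerivAt_blowUp_zero_left N k l c η).sub_const (blowUp N k l c (0, 1)))]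
    refine isInvertible_smul_id_add_conjCLE_comp ?_
    rw [norm_mul, norm_mul _ (k c)]
    exact mul_lt_mul_of_pos_left hkl
      (norm_pos_iff.2 (mul_ne_zero (Nat.cast_ne_zero.2 hN) (pow_ne_zero _ hη0)))
  refine ⟨hG.implicitFunctionOfProdDomain hinv, hG.tendsto_implicitFunctionOfProdDomain hinv, ?_⟩
  filter_upwards [hG.eventually_apply_implicitFunctionOfProdDomain hinv] with t ht
  have hG0 : G (0, η) = 0 := by simp [G, blowUp, hη, -map_pow]
  exact sub_eq_zero.1 (ht.trans hG0)

lemma not_injOn_pow_mul_add_conj {N : ℕ} (hk : AnalyticAt ℂ k c) (hl : AnalyticAt ℂ l c)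
    (hkl : ‖l c‖ < ‖k c‖) (hN : 2 ≤ N) {U : Set ℂ} (hU : U ∈ 𝓝 c) :
    ¬ InjOn (fun z => (z - c) ^ N * k z + conj ((z - c) ^ N * l z)) U := by
  have hprim := Complex.isPrimitiveRoot_exp N (by omega)
  obtain ⟨ψ, hψ, hψ_eq⟩ := exists_tendsto_blowUp_eq hk hl hkl (by omega) hprim.pow_eq_one
  have hmem : ∀ {χ : ℝ → ℂ} {ζ : ℂ}, Tendsto χ (𝓝 0) (𝓝 ζ) → ∀ᶠ t : ℝ in 𝓝 0, c + t * χ t ∈ U :=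
    fun {χ ζ} hχ => by
      have hlim := (tendsto_const_nhds (x := c)).add
        ((Complex.continuous_ofReal.tendsto 0).mul hχ)
      rw [Complex.ofReal_zero, zero_mul, add_zero] at hlim
      exact hlim.eventually hU
  have hψ_ne : ∀ᶠ t in 𝓝 0, ψ t ≠ 1 := hψ.eventually_ne (hprim.ne_one (by omega))
  obtain ⟨t, ⟨⟨⟨ht, hU₁⟩, hU₂⟩, hne⟩, ht0⟩ :=
    ((((hψ_eq.and (hmem hψ)).and (hmem tendsto_const_nhds)).and hψ_ne).filter_mono
      nhdsWithin_le_nhds |>.and (self_mem_nhdsWithin (s := {(0 : ℝ)}ᶜ))).exists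
  intro hinj
  have heq := hinj hU₁ hU₂ <| by
    simp only [add_sub_cancel_left]
    rw [← pow_mul_blowUp, ← pow_mul_blowUp, ht]
  exact hne (mul_left_cancel₀ (Complex.ofReal_ne_zero.2 ht0) (add_left_cancel heq))

/-- **Lewy's theorem**, with the a priori bound `‖g'‖ < ‖h'‖` replacing the study of all possible
leading terms. -/
lemma deriv_ne_zero_of_injOn_add_conj (hh : AnalyticAt ℂ h c) (hg : AnalyticAt ℂ g c)
    (hlt : ∀ᶠ z in 𝓝[≠] c, ‖deriv g z‖ < ‖deriv h z‖) {U : Set ℂ} (hU : U ∈ 𝓝 c)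
    (hinj : InjOn (fun z => h z + conj (g z)) U) : deriv h c ≠ 0 := by
  intro h0
  obtain ⟨N, k, l, hN, hk, hl, hkl, hhk, hgl⟩ :=
    exists_sub_eq_pow_mul_of_deriv_eq_zero hh hg hlt h0
  refine not_injOn_pow_mul_add_conj hk hl hkl hN (inter_mem hU (inter_mem hhk hgl)) ?_
  rintro z ⟨hzU, hhz, hgz⟩ w ⟨hwU, hhw, hgw⟩ hzw
  rw [mem_ofPred_eq] at hhz hgz hhw hgw
  refine hinj hzU hwU ?_
  simp only [← hhz, ← hgz, ← hhw, ← hgw, map_sub] at hzw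
  linear_combination hzw

end Lewy

section Wirtinger

lemma smul_id_add_smul_conjCLE_apply (a b w : ℂ) :
    (a • ContinuousLinearMap.id ℝ ℂ + b • (Complex.conjCLE : ℂ →L[ℝ] ℂ)) w
      = a * w + b * conj w :=
  rfl

/-- `F` is real differentiable at `z`, with Wirtinger derivatives `a` and `b`. -/
def HasWirtingerAt (F : ℂ → ℂ) (a b z : ℂ) : Prop :=
  HasFDerivAt F (a • ContinuousLinearMap.id ℝ ℂ + b • (Complex.conjCLE : ℂ →L[ℝ] ℂ)) z

namespace HasWirtingerAt

variable {F G : ℂ → ℂ} {a b a' b' z : ℂ}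

lemma of_hasFDerivAt {L : ℂ →L[ℝ] ℂ} (hF : HasFDerivAt F L z)
    (hL : ∀ w, L w = a * w + b * conj w) : HasWirtingerAt F a b z :=
  hF.congr_fderiv (ContinuousLinearMap.ext fun w =>
    (hL w).trans (smul_id_add_smul_conjCLE_apply a b w).symm)

lemma dz_eq (hF : HasWirtingerAt F a b z) : dz F z = a := by
  rw [dz, HasFDerivAt.fderiv hF, smul_id_add_smul_conjCLE_apply, smul_id_add_smul_conjCLE_apply,
    map_one, Complex.conj_I]
  linear_combination (b / 2 - a / 2) * Complex.I_sq

lemma dzbar_eq (hF : HasWirtingerAt F a b z) : dzbar F z = b := by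
  rw [dzbar, HasFDerivAt.fderiv hF, smul_id_add_smul_conjCLE_apply, smul_id_add_smul_conjCLE_apply,
    map_one, Complex.conj_I]
  linear_combination (a / 2 - b / 2) * Complex.I_sq

lemma congr_of_eventuallyEq (hF : HasWirtingerAt F a b z) (h : G =ᶠ[𝓝 z] F) :
    HasWirtingerAt G a b z :=
  HasFDerivAt.congr_of_eventuallyEq hF h

lemma of_hasDerivAt (hF : HasDerivAt F a z) : HasWirtingerAt F a 0 z :=
  of_hasFDerivAt (hF.hasFDerivAt.restrictScalars ℝ) fun w => by simp [mul_comm]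

lemma conj_of_hasDerivAt (hF : HasDerivAt F a z) :
    HasWirtingerAt (fun w => conj (F w)) 0 (conj a) z :=
  of_hasFDerivAt (Complex.conjCLE.hasFDerivAt.comp z (hF.hasFDerivAt.restrictScalars ℝ))
    fun w => by simp [mul_comm]

lemma add (hF : HasWirtingerAt F a b z) (hG : HasWirtingerAt G a' b' z) :
    HasWirtingerAt (fun w => F w + G w) (a + a') (b + b') z :=
  of_hasFDerivAt (HasFDerivAt.add hF hG) fun w => by
    rw [add_apply, smul_id_add_smul_conjCLE_apply, smul_id_add_smul_conjCLE_apply]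
    ring

lemma sub (hF : HasWirtingerAt F a b z) (hG : HasWirtingerAt G a' b' z) :
    HasWirtingerAt (fun w => F w - G w) (a - a') (b - b') z :=
  of_hasFDerivAt (HasFDerivAt.sub hF hG) fun w => by
    rw [sub_apply, smul_id_add_smul_conjCLE_apply, smul_id_add_smul_conjCLE_apply]
    ring

lemma mul (hF : HasWirtingerAt F a b z) (hG : HasWirtingerAt G a' b' z) :
    HasWirtingerAt (fun w => F w * G w) (a * G z + F z * a') (b * G z + F z * b') z :=
  of_hasFDerivAt (HasFDerivAt.mul hF hG) fun w => by
    rw [add_apply, smul_apply, smul_apply, smul_id_add_smul_conjCLE_apply,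
      smul_id_add_smul_conjCLE_apply, smul_eq_mul, smul_eq_mul]
    ring

lemma mul_conj_sub_mul_conj {p q r s : ℂ → ℂ} (hp : DifferentiableAt ℂ p z)
    (hq : DifferentiableAt ℂ q z) (hr : DifferentiableAt ℂ r z) (hs : DifferentiableAt ℂ s z) :
    HasWirtingerAt (fun z => p z * conj (q z) - r z * conj (s z))
      (deriv p z * conj (q z) - deriv r z * conj (s z))
      (p z * conj (deriv q z) - r z * conj (deriv s z)) z := by
  have hW := ((of_hasDerivAt hp.hasDerivAt).mul (conj_of_hasDerivAt hq.hasDerivAt)).sub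
    ((of_hasDerivAt hr.hasDerivAt).mul (conj_of_hasDerivAt hs.hasDerivAt))
  simpa only [mul_zero, add_zero, zero_mul, zero_add] using hW

lemma inv (hF : HasWirtingerAt F a b z) (h0 : F z ≠ 0) :
    HasWirtingerAt (fun w => (F w)⁻¹) (-a / F z ^ 2) (-b / F z ^ 2) z :=
  of_hasFDerivAt (((hasDerivAt_inv h0).hasFDerivAt.restrictScalars ℝ).comp z hF) fun w => by
    rw [ContinuousLinearMap.comp_apply, smul_id_add_smul_conjCLE_apply,
      ContinuousLinearMap.coe_restrictScalars', ContinuousLinearMap.toSpanSingleton_apply,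
      smul_eq_mul]
    ring

lemma log {j : ℂ → ℝ} (hj : HasWirtingerAt (fun w => (j w : ℂ)) a b z) (h0 : j z ≠ 0) :
    HasWirtingerAt (fun w => (Real.log (j w) : ℂ)) (a / j z) (b / j z) z := by
  have hre : HasFDerivAt j (Complex.reCLM.comp
      (a • ContinuousLinearMap.id ℝ ℂ + b • (Complex.conjCLE : ℂ →L[ℝ] ℂ))) z :=
    HasFDerivAt.comp (g := Complex.reCLM) z (Complex.reCLM.hasFDerivAt (x := (j z : ℂ))) hj
  have hcoe := Complex.ofRealCLM.hasFDerivAt.comp z hre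
  refine of_hasFDerivAt (Complex.ofRealCLM.hasFDerivAt.comp z (hre.log h0)) fun w => ?_
  have hw := DFunLike.congr_fun (HasFDerivAt.unique hcoe hj) w
  simp only [ContinuousLinearMap.comp_apply, smul_id_add_smul_conjCLE_apply, smul_apply,
    smul_eq_mul, Complex.ofRealCLM_apply, Complex.ofReal_mul, Complex.ofReal_inv] at hw ⊢
  rw [hw]
  ring

end HasWirtingerAt

variable (f : ℂ → ℂ) (z : ℂ)

lemma dz_conj : dz (fun w => conj (f w)) z = conj (dzbar f z) := by
  have hfderiv : fderiv ℝ (fun w => conj (f w)) z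
      = (Complex.conjCLE : ℂ →L[ℝ] ℂ) ∘L fderiv ℝ f z := Complex.conjCLE.comp_fderiv
  simp [dz, dzbar, hfderiv, map_ofNat, sub_eq_add_neg]

lemma dzbar_conj : dzbar (fun w => conj (f w)) z = conj (dz f z) := by
  have hdz := dz_conj (fun w => conj (f w)) z
  simp only [Complex.conj_conj] at hdz
  rw [hdz, Complex.conj_conj]

lemma jacobian_conj : jacobian (fun w => conj (f w)) z = -jacobian f z := by
  simp only [jacobian, dz_conj, dzbar_conj, Complex.norm_conj, neg_sub]

lemma preSchwarzian_conj : preSchwarzian (fun w => conj (f w)) = preSchwarzian f := by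
  simp only [preSchwarzian, jacobian_conj, Real.log_neg_eq_log]

lemma schwarzian_conj : schwarzian (fun w => conj (f w)) z = schwarzian f z := by
  simp only [schwarzian, preSchwarzian_conj]

end Wirtinger

/-- The canonical decomposition `f = h + conj g` of a harmonic mapping on an open set `U` into a
holomorphic part `h` and a co-analytic part `conj g`. -/
structure CanonicalDecomposition (f h g : ℂ → ℂ) (U : Set ℂ) : Prop where
  isOpen : IsOpen U
  differentiableOn_left : DifferentiableOn ℂ h U
  differentiableOn_right : DifferentiableOn ℂ g U
  eqOn : EqOn f (fun z => h z + conj (g z)) U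

lemma exists_canonicalDecomposition_ball {f : ℂ → ℂ} {c : ℂ} {r : ℝ}
    (hf : InnerProductSpace.HarmonicOnNhd f (ball c r)) :
    ∃ h g : ℂ → ℂ, CanonicalDecomposition f h g (ball c r) := by
  obtain ⟨p, hp, hpf⟩ :=
    InnerProductSpace.HarmonicOnNhd.exists_analyticOnNhd_ball_re_eq (hf.comp_CLM Complex.reCLM)
  obtain ⟨q, hq, hqf⟩ :=
    InnerProductSpace.HarmonicOnNhd.exists_analyticOnNhd_ball_re_eq (hf.comp_CLM Complex.imCLM)
  have hp' := hp.differentiableOn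
  have hq' := hq.differentiableOn
  refine ⟨fun z => (p z + Complex.I * q z) / 2, fun z => (p z - Complex.I * q z) / 2,
    isOpen_ball, (hp'.add (hq'.const_mul _)).div_const 2, (hp'.sub (hq'.const_mul _)).div_const 2,
    fun z hz => ?_⟩
  have hre : (p z).re = (f z).re := hpf hz
  have him : (q z).re = (f z).im := hqf hz
  rw [← Complex.re_add_im (f z), ← hre, ← him, Complex.re_eq_add_conj (p z),
    Complex.re_eq_add_conj (q z)]
  simp only [map_div₀, map_sub, map_mul, Complex.conj_I, map_ofNat]
  ring

namespace CanonicalDecomposition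

variable {f h g : ℂ → ℂ} {U : Set ℂ} {z : ℂ}

lemma swap (D : CanonicalDecomposition f h g U) :
    CanonicalDecomposition (fun z => conj (f z)) g h U where
  isOpen := D.isOpen
  differentiableOn_left := D.differentiableOn_right
  differentiableOn_right := D.differentiableOn_left
  eqOn z hz := by
    simp only [D.eqOn hz, map_add, Complex.conj_conj]
    ring

lemma hasWirtingerAt (D : CanonicalDecomposition f h g U) (hz : z ∈ U) :
    HasWirtingerAt f (deriv h z) (conj (deriv g z)) z := by
  have hU := D.isOpen.mem_nhds hz
  have hsum := (HasWirtingerAt.of_hasDerivAt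
    (D.differentiableOn_left.differentiableAt hU).hasDerivAt).add
    (HasWirtingerAt.conj_of_hasDerivAt (D.differentiableOn_right.differentiableAt hU).hasDerivAt)
  rw [add_zero, zero_add] at hsum
  exact hsum.congr_of_eventuallyEq (D.eqOn.eventuallyEq_of_mem hU)

lemma dilatation_eq (D : CanonicalDecomposition f h g U) (hz : z ∈ U) :
    dilatation f z = deriv g z / deriv h z := by
  rw [dilatation, (D.hasWirtingerAt hz).dz_eq, (D.hasWirtingerAt hz).dzbar_eq, Complex.conj_conj]

lemma jacobian_eq (D : CanonicalDecomposition f h g U) (hz : z ∈ U) :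
    jacobian f z = ‖deriv h z‖ ^ 2 - ‖deriv g z‖ ^ 2 := by
  rw [jacobian, (D.hasWirtingerAt hz).dz_eq, (D.hasWirtingerAt hz).dzbar_eq, Complex.norm_conj]

end CanonicalDecomposition

section Shear

/-- The shear `h + b * g` of a pair of holomorphic functions. For a harmonic mapping
`f = h + conj g` and a point `z`, the shear with `b = -conj (ω z)` has the same pre-Schwarzian and
Schwarzian derivatives at `z` as `f`. -/
def shear (h g : ℂ → ℂ) (b : ℂ) (z : ℂ) : ℂ := h z + b * g z

variable {h g ω : ℂ → ℂ} {b z : ℂ}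

lemma deriv_shear (hh : DifferentiableAt ℂ h z) (hg : DifferentiableAt ℂ g z) :
    deriv (shear h g b) z = shear (deriv h) (deriv g) b z :=
  (hh.hasDerivAt.add (hg.hasDerivAt.const_mul b)).deriv

lemma eqOn_deriv_shear {U : Set ℂ} (hU : IsOpen U) (hh : DifferentiableOn ℂ h U)
    (hg : DifferentiableOn ℂ g U) : EqOn (deriv (shear h g b)) (shear (deriv h) (deriv g) b) U :=
  fun _ hz => deriv_shear (hh.differentiableAt (hU.mem_nhds hz))
    (hg.differentiableAt (hU.mem_nhds hz))

lemma eqOn_deriv_deriv_shear {U : Set ℂ} (hU : IsOpen U) (hh : DifferentiableOn ℂ h U)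
    (hg : DifferentiableOn ℂ g U) :
    EqOn (deriv (deriv (shear h g b))) (shear (deriv (deriv h)) (deriv (deriv g)) b) U :=
  ((eqOn_deriv_shear hU hh hg).deriv hU).trans (eqOn_deriv_shear hU (hh.deriv hU) (hg.deriv hU))

lemma logDeriv_deriv_shear (hh : AnalyticAt ℂ h z) (hg : AnalyticAt ℂ g z)
    (hω : AnalyticAt ℂ ω z) (hgω : ∀ᶠ w in 𝓝 z, deriv g w = ω w * deriv h w)
    (h0 : deriv h z ≠ 0) (hb : 1 + b * ω z ≠ 0) :
    logDeriv (deriv (shear h g b)) z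
      = logDeriv (deriv h) z + b * deriv ω z / (1 + b * ω z) := by
  have hfactor : deriv (shear h g b) =ᶠ[𝓝 z] fun w => deriv h w * (1 + b * ω w) := by
    filter_upwards [hgω, hh.eventually_analyticAt, hg.eventually_analyticAt] with w hw hhw hgw
    rw [deriv_shear hhw.differentiableAt hgw.differentiableAt, shear, hw]
    ring
  have hωd : HasDerivAt (fun w => 1 + b * ω w) (b * deriv ω z) z :=
    (hω.differentiableAt.hasDerivAt.const_mul b).const_add 1
  rw [logDeriv_apply, hfactor.deriv_eq, hfactor.self_of_nhds, ← logDeriv_apply,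
    logDeriv_mul z h0 hb hh.deriv.differentiableAt hωd.differentiableAt,
    logDeriv_apply (fun w => 1 + b * ω w), hωd.deriv]

lemma holoSchwarzian_shear (hh : AnalyticAt ℂ h z) (hg : AnalyticAt ℂ g z)
    (hω : AnalyticAt ℂ ω z) (hgω : ∀ᶠ w in 𝓝 z, deriv g w = ω w * deriv h w)
    (h0 : deriv h z ≠ 0) (hb : 1 + b * ω z ≠ 0) :
    holoSchwarzian (shear h g b) z
      = holoSchwarzian h z - logDeriv (deriv h) z * (b * deriv ω z / (1 + b * ω z))
        + b * deriv (deriv ω) z / (1 + b * ω z)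
        - 3 / 2 * (b * deriv ω z / (1 + b * ω z)) ^ 2 := by
  have hωd : HasDerivAt (fun w => 1 + b * ω w) (b * deriv ω z) z :=
    (hω.differentiableAt.hasDerivAt.const_mul b).const_add 1
  have hlog : logDeriv (deriv (shear h g b)) =ᶠ[𝓝 z]
      fun w => logDeriv (deriv h) w + b * deriv ω w / (1 + b * ω w) := by
    filter_upwards [hh.eventually_analyticAt, hg.eventually_analyticAt,
      hω.eventually_analyticAt, hgω.eventually_nhds, hh.deriv.continuousAt.eventually_ne h0,
      hωd.continuousAt.eventually_ne hb] with w hhw hgw hωw hgωw h0w hbw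
    exact logDeriv_deriv_shear hhw hgw hωw hgωw h0w hbw
  have hderiv := (analyticAt_logDeriv_deriv hh h0).differentiableAt.hasDerivAt.fun_add
    ((hω.deriv.differentiableAt.hasDerivAt.const_mul b).fun_div hωd hb)
  rw [holoSchwarzian, holoSchwarzian, hlog.deriv_eq, hlog.self_of_nhds, hderiv.deriv]
  field_simp
  ring

end Shear

namespace CanonicalDecomposition

variable {f h g : ℂ → ℂ} {U : Set ℂ} {z : ℂ}

lemma ofReal_jacobian (D : CanonicalDecomposition f h g U) (hz : z ∈ U) : (jacobian f z : ℂ)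
    = deriv h z * conj (deriv h z) - deriv g z * conj (deriv g z) := by
  rw [D.jacobian_eq hz, Complex.mul_conj', Complex.mul_conj']
  push_cast
  rfl

lemma preSchwarzian_eq_div (D : CanonicalDecomposition f h g U) (hz : z ∈ U)
    (hJ : jacobian f z ≠ 0) : preSchwarzian f z
      = (deriv (deriv h) z * conj (deriv h z) - deriv (deriv g) z * conj (deriv g z))
        / (deriv h z * conj (deriv h z) - deriv g z * conj (deriv g z)) := by
  have hU := D.isOpen.mem_nhds hz
  have hh' := (D.differentiableOn_left.deriv D.isOpen).differentiableAt hU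
  have hg' := (D.differentiableOn_right.deriv D.isOpen).differentiableAt hU
  have hW := (HasWirtingerAt.mul_conj_sub_mul_conj hh' hh' hg' hg').congr_of_eventuallyEq
    (G := fun w => (jacobian f w : ℂ)) <| by
      filter_upwards [hU] with w hw using D.ofReal_jacobian hw
  rw [preSchwarzian, (hW.log hJ).dz_eq, D.ofReal_jacobian hz]

lemma schwarzian_eq_div (D : CanonicalDecomposition f h g U) (hJ : ∀ w ∈ U, jacobian f w ≠ 0)
    (hz : z ∈ U) : schwarzian f z
      = (deriv (deriv (deriv h)) z * conj (deriv h z)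
          - deriv (deriv (deriv g)) z * conj (deriv g z))
          / (deriv h z * conj (deriv h z) - deriv g z * conj (deriv g z))
        - 3 / 2 * preSchwarzian f z ^ 2 := by
  have hU := D.isOpen.mem_nhds hz
  have hh₁ := D.differentiableOn_left.deriv D.isOpen
  have hg₁ := D.differentiableOn_right.deriv D.isOpen
  have hh' := hh₁.differentiableAt hU
  have hg' := hg₁.differentiableAt hU
  have hh'' := (hh₁.deriv D.isOpen).differentiableAt hU
  have hg'' := (hg₁.deriv D.isOpen).differentiableAt hU
  have hne : deriv h z * conj (deriv h z) - deriv g z * conj (deriv g z) ≠ 0 := by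
    rw [← D.ofReal_jacobian hz]
    exact Complex.ofReal_ne_zero.2 (hJ z hz)
  have hW := ((HasWirtingerAt.mul_conj_sub_mul_conj hh'' hh' hg'' hg').mul
    ((HasWirtingerAt.mul_conj_sub_mul_conj hh' hh' hg' hg').inv hne)).congr_of_eventuallyEq
    (G := preSchwarzian f) <| by
      filter_upwards [hU] with w hw
      rw [D.preSchwarzian_eq_div hw (hJ w hw), div_eq_mul_inv]
  rw [schwarzian, hW.dz_eq, D.preSchwarzian_eq_div hz (hJ z hz)]
  field_simp
  ring

lemma jacobian_ne_zero (D : CanonicalDecomposition f h g U) (hz : z ∈ U)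
    (hlt : ‖deriv g z‖ < ‖deriv h z‖) : jacobian f z ≠ 0 := by
  rw [D.jacobian_eq hz]
  exact (sub_pos.2 (pow_lt_pow_left₀ hlt (norm_nonneg _) two_ne_zero)).ne'

lemma shear_neg_conj_dilatation_mul (D : CanonicalDecomposition f h g U) (hz : z ∈ U)
    (h0 : deriv h z ≠ 0) (p q : ℂ → ℂ) :
    shear p q (-conj (dilatation f z)) z * conj (deriv h z)
      = p z * conj (deriv h z) - q z * conj (deriv g z) := by
  rw [shear, D.dilatation_eq hz, map_div₀]
  field_simp [(map_ne_zero (starRingEnd ℂ)).2 h0]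
  ring

lemma preSchwarzian_eq_logDeriv (D : CanonicalDecomposition f h g U) (hz : z ∈ U)
    (hlt : ‖deriv g z‖ < ‖deriv h z‖) :
    preSchwarzian f z = logDeriv (deriv (shear h g (-conj (dilatation f z)))) z := by
  have h0 : deriv h z ≠ 0 := norm_pos_iff.1 ((norm_nonneg _).trans_lt hlt)
  rw [D.preSchwarzian_eq_div hz (D.jacobian_ne_zero hz hlt), logDeriv_apply,
    eqOn_deriv_deriv_shear D.isOpen D.differentiableOn_left D.differentiableOn_right hz,
    eqOn_deriv_shear D.isOpen D.differentiableOn_left D.differentiableOn_right hz,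
    ← D.shear_neg_conj_dilatation_mul hz h0, ← D.shear_neg_conj_dilatation_mul hz h0,
    mul_div_mul_right _ _ ((map_ne_zero (starRingEnd ℂ)).2 h0)]

lemma schwarzian_eq_holoSchwarzian (D : CanonicalDecomposition f h g U)
    (hlt : ∀ w ∈ U, ‖deriv g w‖ < ‖deriv h w‖) (hz : z ∈ U) :
    schwarzian f z = holoSchwarzian (shear h g (-conj (dilatation f z))) z := by
  have h0 : deriv h z ≠ 0 := norm_pos_iff.1 ((norm_nonneg _).trans_lt (hlt z hz))
  have hh₁ := D.differentiableOn_left.deriv D.isOpen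
  have hg₁ := D.differentiableOn_right.deriv D.isOpen
  have hder₁ := eqOn_deriv_shear (b := -conj (dilatation f z)) D.isOpen
    D.differentiableOn_left D.differentiableOn_right
  have hder₃ := (hder₁.deriv D.isOpen |>.deriv D.isOpen).trans
    (eqOn_deriv_deriv_shear D.isOpen hh₁ hg₁)
  have hne : deriv (shear h g (-conj (dilatation f z))) z ≠ 0 := fun hzero => by
    refine D.jacobian_ne_zero hz (hlt z hz) (Complex.ofReal_injective ?_)
    rw [D.ofReal_jacobian hz, ← D.shear_neg_conj_dilatation_mul hz h0, ← hder₁ hz, hzero,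
      zero_mul, Complex.ofReal_zero]
  have hana : AnalyticAt ℂ (shear h g (-conj (dilatation f z))) z :=
    (D.differentiableOn_left.add (D.differentiableOn_right.const_mul _)).analyticAt
      (D.isOpen.mem_nhds hz)
  rw [D.schwarzian_eq_div (fun w hw => D.jacobian_ne_zero hw (hlt w hw)) hz,
    D.preSchwarzian_eq_logDeriv hz (hlt z hz), holoSchwarzian_eq hana hne, logDeriv_apply,
    hder₃ hz, hder₁ hz, ← D.shear_neg_conj_dilatation_mul hz h0,
    ← D.shear_neg_conj_dilatation_mul hz h0,
    mul_div_mul_right _ _ ((map_ne_zero (starRingEnd ℂ)).2 h0)]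

lemma differentiableOn_dilatation (D : CanonicalDecomposition f h g U)
    (hlt : ∀ w ∈ U, ‖deriv g w‖ < ‖deriv h w‖) : DifferentiableOn ℂ (dilatation f) U :=
  ((D.differentiableOn_right.deriv D.isOpen).div (D.differentiableOn_left.deriv D.isOpen)
    fun w hw => norm_pos_iff.1 ((norm_nonneg _).trans_lt (hlt w hw))).congr
    fun _ hw => D.dilatation_eq hw

lemma mapsTo_dilatation (D : CanonicalDecomposition f h g U)
    (hlt : ∀ w ∈ U, ‖deriv g w‖ < ‖deriv h w‖) : MapsTo (dilatation f) U (ball 0 1) := by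
  intro w hw
  rw [D.dilatation_eq hw, mem_ball_zero_iff, norm_div]
  exact (div_lt_one ((norm_nonneg _).trans_lt (hlt w hw))).2 (hlt w hw)

lemma deriv_right_eq (D : CanonicalDecomposition f h g U) (hz : z ∈ U) (h0 : deriv h z ≠ 0) :
    deriv g z = dilatation f z * deriv h z := by
  rw [D.dilatation_eq hz, div_mul_cancel₀ _ h0]

/-- Writing both `S_f` and the Schwarzian derivative of the shear in terms of that of `h` removes
`h` from their difference, which becomes a polynomial in `κ = (a + conj ω) / (1 + a * ω)`. -/
lemma one_sub_norm_sq_sq_mul_holoSchwarzian_shear (D : CanonicalDecomposition f h g U)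
    (hlt : ∀ w ∈ U, ‖deriv g w‖ < ‖deriv h w‖) (hz : z ∈ U) {a κ : ℂ}
    (ha : 1 + a * dilatation f z ≠ 0)
    (hκ : κ = (a + conj (dilatation f z)) / (1 + a * dilatation f z)) :
    (1 - (‖z‖ : ℂ) ^ 2) ^ 2 * holoSchwarzian (shear h g a) z
      = (1 - (‖z‖ : ℂ) ^ 2) ^ 2 * schwarzian f z
        + κ * secondHyperbolicDeriv (dilatation f) z
        - 2 * (κ * (hyperbolicDeriv (dilatation f) z * harmonicOrder f z))
        - 3 / 2 * (κ * hyperbolicDeriv (dilatation f) z) ^ 2 := by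
  have hU := D.isOpen.mem_nhds hz
  have hh := D.differentiableOn_left.analyticAt hU
  have hg := D.differentiableOn_right.analyticAt hU
  have hω := (D.differentiableOn_dilatation hlt).analyticAt hU
  have hh0 : ∀ w ∈ U, deriv h w ≠ 0 := fun w hw =>
    norm_pos_iff.1 ((norm_nonneg _).trans_lt (hlt w hw))
  have hgω : ∀ᶠ w in 𝓝 z, deriv g w = dilatation f w * deriv h w := by
    filter_upwards [hU] with w hw using D.deriv_right_eq hw (hh0 w hw)
  have hnorm : (‖dilatation f z‖ : ℂ) ^ 2 = conj (dilatation f z) * dilatation f z :=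
    (Complex.conj_mul' _).symm
  have hv : 1 + -conj (dilatation f z) * dilatation f z ≠ 0 := by
    rw [neg_mul, ← sub_eq_add_neg, ← hnorm]
    exact_mod_cast (one_sub_norm_sq_pos (D.mapsTo_dilatation hlt hz)).ne'
  rw [hκ, harmonicOrder, D.schwarzian_eq_holoSchwarzian hlt hz, D.preSchwarzian_eq_logDeriv hz
    (hlt z hz), holoSchwarzian_shear hh hg hω hgω (hh0 z hz) ha,
    holoSchwarzian_shear hh hg hω hgω (hh0 z hz) hv,
    logDeriv_deriv_shear hh hg hω hgω (hh0 z hz) hv, secondHyperbolicDeriv, hyperbolicDeriv, hnorm]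
  generalize conj (dilatation f z) = v at hv ⊢
  have hv' : 1 - dilatation f z * v ≠ 0 := by rwa [neg_mul, ← sub_eq_add_neg, mul_comm] at hv
  rw [show 1 + -v * dilatation f z = 1 - dilatation f z * v by ring, mul_comm v (dilatation f z)]
  field_simp
  ring

end CanonicalDecomposition

lemma norm_add_conj_div_one_add_mul {a w : ℂ} (ha : ‖a‖ = 1) (hw : 1 + a * w ≠ 0) :
    ‖(a + conj w) / (1 + a * w)‖ = 1 := by
  have hnum : a + conj w = a * conj (1 + a * w) := by
    have : a * conj a = 1 := by rw [Complex.mul_conj', ha, Complex.ofReal_one, one_pow]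
    simp only [map_add, map_one, map_mul]
    linear_combination -conj w * this
  rw [hnum, norm_div, norm_mul, ha, one_mul, Complex.norm_conj,
    div_self (norm_ne_zero_iff.2 hw)]

lemma norm_add_sub_sub_le_two {κ s t a x : ℂ} (hκ : ‖κ‖ = 1)
    (hx : ‖x‖ ≤ 2 * (1 - ‖t‖ ^ 2)) (h : ‖s‖ + 2 * ‖t * a‖ ≤ 1 / 2 * ‖t‖ ^ 2) :
    ‖s + κ * x - 2 * (κ * (t * a)) - 3 / 2 * (κ * t) ^ 2‖ ≤ 2 :=
  calc ‖s + κ * x - 2 * (κ * (t * a)) - 3 / 2 * (κ * t) ^ 2‖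
      ≤ ‖s‖ + ‖κ * x‖ + ‖2 * (κ * (t * a))‖ + ‖3 / 2 * (κ * t) ^ 2‖ :=
        (norm_sub_le _ _).trans <| by
          gcongr
          exact (norm_sub_le _ _).trans (by gcongr; exact norm_add_le _ _)
    _ = ‖s‖ + ‖x‖ + 2 * ‖t * a‖ + 3 / 2 * ‖t‖ ^ 2 := by simp [hκ]
    _ ≤ 2 := by linarith

/-- The hypothesis of the univalence criterion. -/
def SchwarzianBound (f : ℂ → ℂ) : Prop :=
  ∀ z ∈ ball (0 : ℂ) 1, (1 - ‖z‖ ^ 2) ^ 2 * ‖schwarzian f z‖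
    + 2 * ‖hyperbolicDeriv (dilatation f) z * harmonicOrder f z‖
    ≤ (1 / 2) * ‖hyperbolicDeriv (dilatation f) z‖ ^ 2

section Criterion

variable {f h g : ℂ → ℂ}

lemma SchwarzianBound.norm_holoSchwarzian_shear_le (hB : SchwarzianBound f)
    (D : CanonicalDecomposition f h g (ball 0 1))
    (hlt : ∀ w ∈ ball (0 : ℂ) 1, ‖deriv g w‖ < ‖deriv h w‖) {a z : ℂ} (ha : ‖a‖ = 1)
    (hz : z ∈ ball (0 : ℂ) 1) :
    (1 - ‖z‖ ^ 2) ^ 2 * ‖holoSchwarzian (shear h g a) z‖ ≤ 2 := by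
  have hω := D.mapsTo_dilatation hlt
  have haω : 1 + a * dilatation f z ≠ 0 := one_add_mul_ne_zero ha.le (hω hz)
  have hnorm : ∀ s : ℂ, (1 - ‖z‖ ^ 2) ^ 2 * ‖s‖ = ‖(1 - (‖z‖ : ℂ) ^ 2) ^ 2 * s‖ := fun s => by
    rw [norm_mul, norm_pow, ← Complex.ofReal_pow, ← Complex.ofReal_one, ← Complex.ofReal_sub,
      Complex.norm_of_nonneg (one_sub_norm_sq_pos hz).le]
  have hBz := hB z hz
  rw [hnorm] at hBz ⊢
  rw [D.one_sub_norm_sq_sq_mul_holoSchwarzian_shear hlt hz haω rfl]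
  exact norm_add_sub_sub_le_two (norm_add_conj_div_one_add_mul ha haω)
    (norm_secondHyperbolicDeriv_le (D.differentiableOn_dilatation hlt) hω hz) hBz

lemma injOn_add_conj_of_forall_injOn_shear {U : Set ℂ}
    (hinj : ∀ a : ℂ, ‖a‖ = 1 → InjOn (shear h g a) U) :
    InjOn (fun z => h z + conj (g z)) U := by
  intro z hz w hw hzw
  have hsub : h z - h w = -conj (g z - g w) := by
    rw [map_sub]
    linear_combination hzw
  obtain ⟨a, ha, hag⟩ : ∃ a : ℂ, ‖a‖ = 1 ∧ a * (g z - g w) = conj (g z - g w) := by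
    by_cases hg : g z - g w = 0
    · exact ⟨1, norm_one, by simp [hg]⟩
    · refine ⟨conj (g z - g w) / (g z - g w), ?_, div_mul_cancel₀ _ hg⟩
      rw [norm_div, Complex.norm_conj, div_self (norm_ne_zero_iff.2 hg)]
  refine hinj a ha hz hw ?_
  rw [shear, shear]
  linear_combination hsub + hag

lemma SchwarzianBound.injOn (hB : SchwarzianBound f)
    (D : CanonicalDecomposition f h g (ball 0 1))
    (hlt : ∀ w ∈ ball (0 : ℂ) 1, ‖deriv g w‖ < ‖deriv h w‖) : InjOn f (ball 0 1) := by
  refine (injOn_add_conj_of_forall_injOn_shear fun a ha => ?_).congr D.eqOn.symm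
  refine injOn_of_norm_holoSchwarzian_le
    (D.differentiableOn_left.add (D.differentiableOn_right.const_mul a)) (fun z hz => ?_)
    fun z hz => hB.norm_holoSchwarzian_shear_le D hlt ha hz
  rw [eqOn_deriv_shear D.isOpen D.differentiableOn_left D.differentiableOn_right hz]
  intro hzero
  refine (hlt z hz).ne' ?_
  rw [eq_neg_of_add_eq_zero_left hzero, norm_neg, norm_mul, ha, one_mul]

lemma LocallyUnivalentOn.exists_mem_nhds {U : Set ℂ} {c : ℂ} (hf : LocallyUnivalentOn f U)
    (hU : IsOpen U) (hc : c ∈ U) : ∃ V ∈ 𝓝 c, V ⊆ U ∧ InjOn f V := by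
  obtain ⟨W, hWo, hcW, hW⟩ := hf ⟨c, hc⟩
  exact ⟨Subtype.val '' W, (hU.isOpenMap_subtype_val W hWo).mem_nhds ⟨_, hcW, rfl⟩,
    Subtype.coe_image_subset U W, hW.image_of_comp⟩

lemma LocallyUnivalentOn.injective_comp {U : Set ℂ} (hf : LocallyUnivalentOn f U) {φ : ℂ → ℂ}
    (hφ : Function.Injective φ) : LocallyUnivalentOn (fun z => φ (f z)) U := fun x =>
  let ⟨W, hWo, hxW, hW⟩ := hf x
  ⟨W, hWo, hxW, fun _ hy _ hz hyz => hW hy hz (hφ hyz)⟩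

namespace CanonicalDecomposition

variable {U : Set ℂ}

lemma norm_deriv_lt (D : CanonicalDecomposition f h g U) (hf : LocallyUnivalentOn f U)
    (hlt : ∀ᶠ z in codiscreteWithin U, ‖deriv g z‖ < ‖deriv h z‖) {c : ℂ} (hc : c ∈ U) :
    ‖deriv g c‖ < ‖deriv h c‖ := by
  have hU := D.isOpen.mem_nhds hc
  have hh := D.differentiableOn_left.analyticAt hU
  have hg := D.differentiableOn_right.analyticAt hU
  have hltc : ∀ᶠ z in 𝓝[≠] c, ‖deriv g z‖ < ‖deriv h z‖ := by
    filter_upwards [mem_codiscreteWithin_iff_forall_mem_nhdsNE.1 hlt c hc,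
      mem_nhdsWithin_of_mem_nhds hU] with z hz hzU using hz.resolve_right (not_not_intro hzU)
  obtain ⟨V, hV, hVU, hinj⟩ := hf.exists_mem_nhds D.isOpen hc
  have hh0 : deriv h c ≠ 0 :=
    deriv_ne_zero_of_injOn_add_conj hh hg hltc hV (hinj.congr (D.eqOn.mono hVU))
  obtain ⟨ω, -, hω, hgω⟩ := exists_analyticAt_eventuallyEq_mul_of_norm_lt hh.deriv hg.deriv hltc
  rw [hgω.self_of_nhds, norm_mul]
  exact mul_lt_of_lt_one_left (norm_pos_iff.2 hh0) hω

lemma eventually_norm_deriv_lt (D : CanonicalDecomposition f h g U)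
    (hω : MapsTo (dilatation f) U (ball 0 1))
    (h0 : ∀ᶠ z in codiscreteWithin U, deriv h z ≠ 0) :
    ∀ᶠ z in codiscreteWithin U, ‖deriv g z‖ < ‖deriv h z‖ := by
  filter_upwards [h0, self_mem_codiscreteWithin U] with z hz hzU
  have hlt := hω hzU
  rwa [D.dilatation_eq hzU, mem_ball_zero_iff, norm_div, div_lt_one (norm_pos_iff.2 hz)] at hlt

lemma not_eqOn_deriv_right_zero (D : CanonicalDecomposition f h g U)
    (hf : LocallyUnivalentOn f U) (hU : IsPreconnected U) (hne : U.Nonempty)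
    (hh0 : EqOn (deriv h) 0 U) : ¬ EqOn (deriv g) 0 U := by
  intro hg0
  obtain ⟨c, hc⟩ := hne
  obtain ⟨V, hV, hVU, hinj⟩ := hf.exists_mem_nhds D.isOpen hc
  obtain ⟨z, hzV, hzc⟩ := Filter.nonempty_of_mem
    (inter_mem (mem_nhdsWithin_of_mem_nhds hV) (self_mem_nhdsWithin (s := {c}ᶜ)))
  refine hzc (hinj hzV (mem_of_mem_nhds hV) ?_)
  simp only [D.eqOn (hVU hzV), D.eqOn hc,
    D.isOpen.is_const_of_deriv_eq_zero hU D.differentiableOn_left hh0 (hVU hzV) hc,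
    D.isOpen.is_const_of_deriv_eq_zero hU D.differentiableOn_right hg0 (hVU hzV) hc]

end CanonicalDecomposition

lemma hyperbolicDeriv_eq_zero {ω : ℂ → ℂ} {U : Set ℂ} {z : ℂ} (hω : EqOn ω 0 U) (hU : U ∈ 𝓝 z) :
    hyperbolicDeriv ω z = 0 := by
  rw [hyperbolicDeriv, (hω.eventuallyEq_of_mem hU).deriv_eq, deriv_zero, Pi.zero_apply,
    mul_zero, zero_div]

lemma SchwarzianBound.of_dilatation_eq_zero (hB : SchwarzianBound f) {F : ℂ → ℂ}
    (hf : EqOn (dilatation f) 0 (ball 0 1)) (hF : EqOn (dilatation F) 0 (ball 0 1))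
    (hS : EqOn (schwarzian F) (schwarzian f) (ball 0 1)) : SchwarzianBound F := by
  intro z hz
  have hU := isOpen_ball.mem_nhds hz
  have hBz := hB z hz
  rw [hyperbolicDeriv_eq_zero hf hU, zero_mul] at hBz
  rwa [hyperbolicDeriv_eq_zero hF hU, zero_mul, hS hz]

lemma SchwarzianBound.injOn_of_eventually_norm_deriv_lt (hB : SchwarzianBound f)
    (D : CanonicalDecomposition f h g (ball 0 1)) (hf : LocallyUnivalentOn f (ball 0 1))
    (hlt : ∀ᶠ z in codiscreteWithin (ball 0 1), ‖deriv g z‖ < ‖deriv h z‖) :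
    InjOn f (ball 0 1) :=
  hB.injOn D fun _ hc => D.norm_deriv_lt hf hlt hc

/-- Since `x / 0 = 0`, an antiholomorphic `f` has dilatation `0`, as has the holomorphic `conj f`,
to which the criterion is applied instead. -/
lemma SchwarzianBound.injOn_of_deriv_left_eq_zero (hB : SchwarzianBound f)
    (D : CanonicalDecomposition f h g (ball 0 1)) (hf : LocallyUnivalentOn f (ball 0 1))
    (hh0 : EqOn (deriv h) 0 (ball 0 1)) : InjOn f (ball 0 1) := by
  have hpc : IsPreconnected (ball (0 : ℂ) 1) := (convex_ball 0 1).isPreconnected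
  have hg0 : ∀ᶠ z in codiscreteWithin (ball 0 1), deriv g z ≠ 0 :=
    ((D.differentiableOn_right.analyticOnNhd D.isOpen).deriv
      |>.eqOn_zero_or_eventually_ne_zero_of_preconnected hpc).resolve_left
      (D.not_eqOn_deriv_right_zero hf hpc (nonempty_ball.2 one_pos) hh0)
  have hlt : ∀ᶠ z in codiscreteWithin (ball 0 1), ‖deriv h z‖ < ‖deriv g z‖ := by
    filter_upwards [hg0, self_mem_codiscreteWithin _] with z hz hzU
    rw [hh0 hzU, Pi.zero_apply, norm_zero]
    exact norm_pos_iff.2 hz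
  have hB' : SchwarzianBound fun z => conj (f z) := by
    refine hB.of_dilatation_eq_zero (fun z hz => ?_) (fun z hz => ?_)
      fun z _ => schwarzian_conj f z
    · rw [D.dilatation_eq hz, hh0 hz, Pi.zero_apply, div_zero]
    · rw [D.swap.dilatation_eq hz, hh0 hz, Pi.zero_apply, zero_div]
  have hinj := hB'.injOn_of_eventually_norm_deriv_lt D.swap
    (hf.injective_comp (starRingEnd ℂ).injective) hlt
  exact fun z hz w hw hzw => hinj hz hw (congrArg conj hzw)

end Criterion

end PlanarHarmonic

open PlanarHarmonic

theorem theorem2 (f : ℂ → ℂ)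
    (hharm : InnerProductSpace.HarmonicOnNhd f (Metric.ball (0 : ℂ) 1))
    (hloc : PlanarHarmonic.LocallyUnivalentOn f (Metric.ball (0 : ℂ) 1))
    (hdil : Set.MapsTo (PlanarHarmonic.dilatation f) (Metric.ball (0 : ℂ) 1)
      (Metric.ball (0 : ℂ) 1))
    (hineq : ∀ z ∈ Metric.ball (0 : ℂ) 1,
      (1 - ‖z‖ ^ 2) ^ 2 * ‖PlanarHarmonic.schwarzian f z‖
        + 2 * ‖PlanarHarmonic.hyperbolicDeriv (PlanarHarmonic.dilatation f) z
            * PlanarHarmonic.harmonicOrder f z‖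
        ≤ (1 / 2) * ‖PlanarHarmonic.hyperbolicDeriv (PlanarHarmonic.dilatation f) z‖ ^ 2) :
    Set.InjOn f (Metric.ball (0 : ℂ) 1) := by
  obtain ⟨h, g, D⟩ := exists_canonicalDecomposition_ball hharm
  have hB : SchwarzianBound f := hineq
  rcases (D.differentiableOn_left.analyticOnNhd D.isOpen).deriv
      |>.eqOn_zero_or_eventually_ne_zero_of_preconnected (convex_ball 0 1).isPreconnected
    with hh0 | hh0
  · exact hB.injOn_of_deriv_left_eq_zero D hloc hh0
  · exact hB.injOn_of_eventually_norm_deriv_lt D hloc (D.eventually_norm_deriv_lt hdil hh0)
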